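/- Let $G$ be a real Lie group (finite-dimensional) acting smoothly and transitively on a connected smooth manifold $M$, let $H$ be the isotropy group at a point $o\in M$, and let $M=G/H$ as manifolds (i.e. the orbit map $a\mapsto a\cdot o$ is a submersion). Suppose the action is almost effective, i.e. the elements of $G$ acting as the identity form a discrete subgroup. Let $\mathfrak g,\mathfrak h$ be the Lie algebras of $G,H$. A reductive decomposition is a vector space decomposition $\mathfrak g=\mathfrak h\oplus\mathfrak m$ with $\mathrm{Ad}(H)\mathfrak m\subseteq\mathfrak m$; given a $G$-invariant pseudo-Riemannian metric on $M$, $\langle\,,\rangle$ also denotes its pull-back to $\mathfrak m$ under the isomorphism $\mathfrak m\to T_oM$, $x\mapsto \frac{d}{dt}\big|_{0}\exp(tx)\cdot o$. The metric is naturally reductive with respect to $\mathfrak g=\mathfrak h\oplus\mathfrak m$ if $\langle[x,y]_{\mathfrak m},z\rangle+\langle y,[x,z]_{\mathfrak m}\rangle=0$ for all $x,y,z\in\mathfrak m$. (1) Let $\langle\,,\rangle$ be a $G$-invariant pseudo-Riemannian metric on $M$ which is naturally reductive with respect to a reductive decomposition $\mathfrak g=\mathfrak h\oplus\mathfrak m$.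 Then $\bar{\mathfrak g}=\mathfrak m+[\mathfrak m,\mathfrak m]$ is an ideal of $\mathfrak g$; the corresponding analytic subgroup $\bar G$ of $G$ is transitive on $M$; the isotropy algebra at $o$ in $\bar{\mathfrak g}$ (the elements of $\bar{\mathfrak g}$ belonging to the Lie algebra of $H\cap\bar G$) is $\mathfrak h\cap\bar{\mathfrak g}$; and there is a unique $\mathrm{Ad}(\bar G)$-invariant symmetric nondegenerate bilinear form $Q$ on $\bar{\mathfrak g}$ such that $$Q(\mathfrak h\cap\bar{\mathfrak g},\mathfrak m)=0,\qquad Q|_{\mathfrak m\times\mathfrak m}=\langle\,,\rangle .$$ (2) Conversely, suppose $G$ is connected, and let $Q$ be an $\mathrm{Ad}(G)$-invariant symmetric nondegenerate bilinear form on $\mathfrak g$ whose restriction to $\mathfrak h$ is nondegenerate. Put $\mathfrak m=\mathfrak h^{\perp}$ (with respect to $Q$). Then there is a unique $G$-invariant pseudo-Riemannian metric on $M$ with $\langle\,,\rangle=Q|_{\mathfrak m\times\mathfrak m}$, it is naturally reductive with respect to the reductive decomposition $\mathfrak g=\mathfrak h\oplus\mathfrak m$, and $\mathfrak g=\mathfrak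 m+[\mathfrak m,\mathfrak m]$. -/

import Mathlib

open scoped Manifold ContDiff Bundle

noncomputable section

namespace NaturallyReductive

section PseudoRiemannian

variable {E' : Type*} [NormedAddCommGroup E'] [NormedSpace ℝ E']

/-- A smooth pseudo-Riemannian metric on a smooth manifold `M` modelled on `E'`: a smooth field of
nondegenerate symmetric bilinear forms on the tangent spaces. -/
structure PseudoRiemannianMetric (E' : Type*) [NormedAddCommGroup E'] [NormedSpace ℝ E']
    (M : Type*) [TopologicalSpace M] [ChartedSpace E' M] [IsManifold 𝓘(ℝ, E') ∞ M] where
  /-- The scalar product on each tangent space. -/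
  inner (p : M) : TangentSpace 𝓘(ℝ, E') p →L[ℝ] TangentSpace 𝓘(ℝ, E') p →L[ℝ] ℝ
  symm (p : M) (v w : TangentSpace 𝓘(ℝ, E') p) : inner p v w = inner p w v
  nondegenerate (p : M) (v : TangentSpace 𝓘(ℝ, E') p) (hv : ∀ w, inner p v w = 0) : v = 0
  contMDiff : ContMDiff 𝓘(ℝ, E') (𝓘(ℝ, E').prod 𝓘(ℝ, E' →L[ℝ] E' →L[ℝ] ℝ)) ∞
    (fun p : M ↦ Bundle.TotalSpace.mk' (E' →L[ℝ] E' →L[ℝ] ℝ)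
      (E := fun p : M ↦ TangentSpace 𝓘(ℝ, E') p →L[ℝ] TangentSpace 𝓘(ℝ, E') p →L[ℝ] ℝ)
      p (inner p))

/-- The group `G` acts on `M` by isometries of the metric. -/
def PseudoRiemannianMetric.IsInvariant (G : Type*) [Group G]
    {M : Type*} [TopologicalSpace M] [ChartedSpace E' M] [IsManifold 𝓘(ℝ, E') ∞ M]
    [MulAction G M] (met : PseudoRiemannianMetric E' M) : Prop :=
  ∀ (a : G) (p : M) (v w : TangentSpace 𝓘(ℝ, E') p),
    met.inner (a • p)
      (mfderiv 𝓘(ℝ, E') 𝓘(ℝ, E') (fun q : M ↦ a • q) p v)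
      (mfderiv 𝓘(ℝ, E') 𝓘(ℝ, E') (fun q : M ↦ a • q) p w) = met.inner p v w

end PseudoRiemannian

section LieTheory

variable {E : Type*} [NormedAddCommGroup E] [NormedSpace ℝ E]
  {G : Type*} [TopologicalSpace G] [ChartedSpace E G] [Group G]

/-- The adjoint representation: `Ad a` is the derivative at `1` of `b ↦ a * b * a⁻¹`. -/
def Ad (a : G) : GroupLieAlgebra 𝓘(ℝ, E) G →L[ℝ] GroupLieAlgebra 𝓘(ℝ, E) G :=
  (mfderiv 𝓘(ℝ, E) 𝓘(ℝ, E) (fun b : G ↦ a * b * a⁻¹) 1 : E →L[ℝ] E)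

/-- The velocity at time `0` of a curve `γ` in `G` with `γ 0 = 1`, as an element of the Lie
algebra. (Only used for such curves.) -/
def velocity (E : Type*) [NormedAddCommGroup E] [NormedSpace ℝ E]
    {G : Type*} [TopologicalSpace G] [ChartedSpace E G] [Group G]
    (γ : ℝ → G) : GroupLieAlgebra 𝓘(ℝ, E) G :=
  (mfderiv 𝓘(ℝ, ℝ) 𝓘(ℝ, E) γ 0 : ℝ →L[ℝ] E) 1

/-- `γ` is the one-parameter subgroup `t ↦ exp (t x)`: the smooth homomorphism from `ℝ` to `G`
with velocity `x` at `0`. -/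
structure IsOneParameterSubgroup (γ : ℝ → G) (x : GroupLieAlgebra 𝓘(ℝ, E) G) : Prop where
  smooth : ContMDiff 𝓘(ℝ, ℝ) 𝓘(ℝ, E) ∞ γ
  map_add : ∀ s t, γ (s + t) = γ s * γ t
  velocity_eq : velocity E γ = x

/-- The analytic subgroup of `G` belonging to a subalgebra `k` of its Lie algebra: the subgroup
generated by `exp k`, that is by all `γ 1` with `γ` a one-parameter subgroup whose velocity is
in `k`. -/
def analyticSubgroup (k : Submodule ℝ (GroupLieAlgebra 𝓘(ℝ, E) G)) : Subgroup G :=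
  Subgroup.closure {a | ∃ x ∈ k, ∃ γ : ℝ → G, IsOneParameterSubgroup γ x ∧ γ 1 = a}

theorem velocity_const : velocity E (fun _ : ℝ ↦ (1 : G)) = 0 := by
  simp [velocity, mfderiv_const]

theorem velocity_comp_mul {γ : ℝ → G} (hγ : ContMDiff 𝓘(ℝ, ℝ) 𝓘(ℝ, E) ∞ γ) (c : ℝ) :
    velocity E (fun t ↦ γ (c * t)) = c • velocity E γ := by
  have hm : HasMFDerivAt 𝓘(ℝ, ℝ) 𝓘(ℝ, ℝ) (fun t : ℝ ↦ c * t) 0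
      (c • ContinuousLinearMap.id ℝ ℝ) :=
    ((hasFDerivAt_id (0 : ℝ)).const_smul c).hasMFDerivAt
  have hg : MDifferentiableAt 𝓘(ℝ, ℝ) 𝓘(ℝ, E) γ (c * 0) := hγ.mdifferentiableAt (by simp)
  have hd := (hg.hasMFDerivAt.comp (0 : ℝ) hm).mfderiv
  have he : velocity E (fun t ↦ γ (c * t)) =
      (mfderiv 𝓘(ℝ, ℝ) 𝓘(ℝ, E) γ (c * 0) : ℝ →L[ℝ] E) ((c • ContinuousLinearMap.id ℝ ℝ) 1) :=
    congrArg (fun L : ℝ →L[ℝ] E ↦ L 1) hd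
  rw [he, mul_zero]
  exact (mfderiv 𝓘(ℝ, ℝ) 𝓘(ℝ, E) γ 0 : ℝ →L[ℝ] E).map_smul c 1

variable [LieGroup 𝓘(ℝ, E) ∞ G]

theorem velocity_mul {γ δ : ℝ → G} (hγ : ContMDiff 𝓘(ℝ, ℝ) 𝓘(ℝ, E) ∞ γ)
    (hδ : ContMDiff 𝓘(ℝ, ℝ) 𝓘(ℝ, E) ∞ δ) (hγ0 : γ 0 = 1) (hδ0 : δ 0 = 1) :
    velocity E (fun t ↦ γ t * δ t) = velocity E γ + velocity E δ := by
  have hF : ContMDiff (𝓘(ℝ, ℝ).prod 𝓘(ℝ, ℝ)) 𝓘(ℝ, E) ∞ (fun p : ℝ × ℝ ↦ γ p.1 * δ p.2) :=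
    (hγ.comp contMDiff_fst).mul (hδ.comp contMDiff_snd)
  have hF0 : MDifferentiableAt (𝓘(ℝ, ℝ).prod 𝓘(ℝ, ℝ)) 𝓘(ℝ, E)
      (fun p : ℝ × ℝ ↦ γ p.1 * δ p.2) ((0 : ℝ), (0 : ℝ)) :=
    hF.mdifferentiableAt (by simp)
  have hd := mfderiv_comp (I := 𝓘(ℝ, ℝ)) (I' := 𝓘(ℝ, ℝ).prod 𝓘(ℝ, ℝ)) (I'' := 𝓘(ℝ, E))
    (0 : ℝ) (f := fun t : ℝ ↦ (t, t)) hF0 (mdifferentiableAt_id.prodMk mdifferentiableAt_id)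
  have hd' : mfderiv 𝓘(ℝ, ℝ) (𝓘(ℝ, ℝ).prod 𝓘(ℝ, ℝ)) (fun t : ℝ ↦ (t, t)) 0 =
      (ContinuousLinearMap.id ℝ ℝ).prod (ContinuousLinearMap.id ℝ ℝ) := by
    have := mdifferentiableAt_id.mfderiv_prod (I := 𝓘(ℝ, ℝ)) (I' := 𝓘(ℝ, ℝ)) (I'' := 𝓘(ℝ, ℝ))
      (x := (0 : ℝ)) (f := id) (g := id) mdifferentiableAt_id
    rw [mfderiv_id] at this
    exact this
  have hs := mfderiv_prod_eq_add_apply (v := ((1 : ℝ), (1 : ℝ))) hF0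
  have h1 : (fun t ↦ γ t * δ 0) = γ := by simp [hδ0]
  have h2 : (fun t ↦ γ 0 * δ t) = δ := by simp [hγ0]
  have he : velocity E (fun t ↦ γ t * δ t) =
      mfderiv (𝓘(ℝ, ℝ).prod 𝓘(ℝ, ℝ)) 𝓘(ℝ, E) (fun p : ℝ × ℝ ↦ γ p.1 * δ p.2)
        ((0 : ℝ), (0 : ℝ)) ((1 : ℝ), (1 : ℝ)) := by
    rw [hd'] at hd
    exact congrArg (fun L : ℝ →L[ℝ] E ↦ L 1) hd
  have hs' : velocity E (fun t ↦ γ t * δ t) =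
      velocity E (fun t ↦ γ t * δ 0) + velocity E (fun t ↦ γ 0 * δ t) := he.trans hs
  rwa [h1, h2] at hs'

/-- The Lie algebra of a subgroup `H` of `G`: all velocities at `1` of smooth curves of `G` that
stay in `H`. -/
def lieAlgebraOf (H : Subgroup G) : Submodule ℝ (GroupLieAlgebra 𝓘(ℝ, E) G) where
  carrier := {x | ∃ γ : ℝ → G, ContMDiff 𝓘(ℝ, ℝ) 𝓘(ℝ, E) ∞ γ ∧ γ 0 = 1 ∧ (∀ t, γ t ∈ H) ∧
    velocity E γ = x}
  add_mem' := by
    rintro _ _ ⟨γ, hγ, hγ0, hγH, rfl⟩ ⟨δ, hδ, hδ0, hδH, rfl⟩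
    exact ⟨fun t ↦ γ t * δ t, hγ.mul hδ, by simp [hγ0, hδ0],
      fun t ↦ H.mul_mem (hγH t) (hδH t), velocity_mul hγ hδ hγ0 hδ0⟩
  zero_mem' := ⟨fun _ ↦ 1, contMDiff_const, rfl, fun _ ↦ H.one_mem, velocity_const⟩
  smul_mem' := by
    rintro c _ ⟨γ, hγ, hγ0, hγH, rfl⟩
    refine ⟨fun t ↦ γ (c * t), ?_, by simp [hγ0], fun t ↦ hγH _, velocity_comp_mul hγ c⟩
    exact hγ.comp (contDiff_const.mul contDiff_id).contMDiff

/-- The subspace `m + [m, m]` of the Lie algebra, where `[m, m]` is the span of all brackets. -/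
def addBracket (m : Submodule ℝ (GroupLieAlgebra 𝓘(ℝ, E) G)) :
    Submodule ℝ (GroupLieAlgebra 𝓘(ℝ, E) G) :=
  m ⊔ Submodule.span ℝ {z | ∃ x ∈ m, ∃ y ∈ m, ⁅x, y⁆ = z}

/-- The bilinear form `Q` on the subspace `k` is invariant under `Ad a` for all `a` in the
subgroup `K`; this includes that `Ad a` maps `k` into itself. -/
def IsAdInvariantOn (K : Subgroup G) (k : Submodule ℝ (GroupLieAlgebra 𝓘(ℝ, E) G))
    (Q : LinearMap.BilinForm ℝ k) : Prop :=
  ∀ a ∈ K, ∃ hk : ∀ x ∈ k, Ad a x ∈ k,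
    ∀ x y : k, Q ⟨Ad a x, hk x x.2⟩ ⟨Ad a y, hk y y.2⟩ = Q x y

end LieTheory

section Homogeneous

variable {E : Type*} [NormedAddCommGroup E] [NormedSpace ℝ E]
  {E' : Type*} [NormedAddCommGroup E'] [NormedSpace ℝ E']
  {G : Type*} [TopologicalSpace G] [ChartedSpace E G] [Group G]
  {M : Type*} [TopologicalSpace M] [ChartedSpace E' M] [MulAction G M]

/-- The identification map `x ↦ x^•_o = d/dt|₀ exp (t x) • o` from the Lie algebra to the tangent
space at `o`, that is the derivative at `1` of the orbit map `a ↦ a • o`. -/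
def orbitDeriv (E : Type*) [NormedAddCommGroup E] [NormedSpace ℝ E]
    {E' : Type*} [NormedAddCommGroup E'] [NormedSpace ℝ E']
    (G : Type*) [TopologicalSpace G] [ChartedSpace E G] [Group G]
    {M : Type*} [TopologicalSpace M] [ChartedSpace E' M] [MulAction G M]
    (o : M) : GroupLieAlgebra 𝓘(ℝ, E) G →L[ℝ] TangentSpace 𝓘(ℝ, E') o :=
  (mfderiv 𝓘(ℝ, E) 𝓘(ℝ, E') (fun a : G ↦ a • o) 1 : E →L[ℝ] E')

/-- `M` is the homogeneous manifold `G/H` with `H` the isotropy group at `o`: the action is smooth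
and transitive and the orbit map `G → M`, `a ↦ a • o` is a submersion (at `1`, hence everywhere by
equivariance), so that `M` carries the quotient smooth structure of `G/H`. -/
structure IsHomogeneousSpace (E : Type*) [NormedAddCommGroup E] [NormedSpace ℝ E]
    (E' : Type*) [NormedAddCommGroup E'] [NormedSpace ℝ E']
    (G : Type*) [TopologicalSpace G] [ChartedSpace E G] [Group G]
    {M : Type*} [TopologicalSpace M] [ChartedSpace E' M] [MulAction G M] (o : M) : Prop where
  smooth : ContMDiffSMul 𝓘(ℝ, E) 𝓘(ℝ, E') ∞ G M
  transitive : MulAction.IsPretransitive G M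
  submersion : Function.Surjective (orbitDeriv (E' := E') E G o)

/-- The action is almost effective: the elements of `G` acting as the identity transformation form
a discrete subgroup. -/
def IsAlmostEffective (G : Type*) [TopologicalSpace G] [Group G] (M : Type*) [MulAction G M] :
    Prop :=
  DiscreteTopology {a : G | ∀ p : M, a • p = p}

/-- The Lie algebra `h` of the isotropy group `H` at `o`. -/
abbrev isotropyAlgebra (E : Type*) [NormedAddCommGroup E] [NormedSpace ℝ E]
    (G : Type*) [TopologicalSpace G] [ChartedSpace E G] [Group G] [LieGroup 𝓘(ℝ, E) ∞ G]
    {M : Type*} [MulAction G M] (o : M) : Submodule ℝ (GroupLieAlgebra 𝓘(ℝ, E) G) :=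
  lieAlgebraOf (MulAction.stabilizer G o)

/-- `g = h ⊕ m` is a reductive decomposition: `m` is a complement of `h` with `Ad(H) m ⊆ m`. -/
structure IsReductiveDecomposition [LieGroup 𝓘(ℝ, E) ∞ G] (o : M)
    (m : Submodule ℝ (GroupLieAlgebra 𝓘(ℝ, E) G)) : Prop where
  isCompl : IsCompl m (isotropyAlgebra E G o)
  ad_mem : ∀ a ∈ MulAction.stabilizer G o, ∀ x ∈ m, Ad a x ∈ m

variable [IsManifold 𝓘(ℝ, E') ∞ M]

/-- The scalar product at `o` pulled back by `x ↦ x^•_o`; on a complement `m` of `h` this is the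
metric of `M` under the identification of `m` with the tangent space at `o`. -/
def metricAt (E : Type*) [NormedAddCommGroup E] [NormedSpace ℝ E]
    {E' : Type*} [NormedAddCommGroup E'] [NormedSpace ℝ E']
    (G : Type*) [TopologicalSpace G] [ChartedSpace E G] [Group G]
    {M : Type*} [TopologicalSpace M] [ChartedSpace E' M] [MulAction G M]
    [IsManifold 𝓘(ℝ, E') ∞ M] (met : PseudoRiemannianMetric E' M) (o : M)
    (x y : GroupLieAlgebra 𝓘(ℝ, E) G) : ℝ :=
  met.inner o (orbitDeriv E G o x) (orbitDeriv E G o y)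

/-- The reductive decomposition `g = h ⊕ m` makes the metric naturally reductive:
`⟨[x, y]_m, z⟩ + ⟨y, [x, z]_m⟩ = 0` for `x, y, z` in `m`. The homogeneous space `M = G/H` is
naturally reductive if there is such an `m`. -/
structure IsNaturallyReductiveDecomposition [LieGroup 𝓘(ℝ, E) ∞ G]
    (met : PseudoRiemannianMetric E' M) (o : M)
    (m : Submodule ℝ (GroupLieAlgebra 𝓘(ℝ, E) G)) : Prop
    extends IsReductiveDecomposition o m where
  skew : ∀ x ∈ m, ∀ y ∈ m, ∀ z ∈ m,
    metricAt E G met o (m.projection (isotropyAlgebra E G o) isCompl ⁅x, y⁆) z +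
      metricAt E G met o y (m.projection (isotropyAlgebra E G o) isCompl ⁅x, z⁆) = 0

end Homogeneous

end NaturallyReductive

end

/-!
Part (1). The bilinear form sought on `m + [m, m]` is Kostant's: it is the metric on `m`, makes
`m` and `h` orthogonal, and on `h ∩ (m + [m, m])`, which is spanned by the `h`-components
`[x, y]_h` with `x, y ∈ m`, it has to satisfy `Q([x, y]_h, [z, w]_h) = ⟨[[x, y]_h, z], w⟩`. It is
well defined and symmetric because the right hand side, as a function of `x, y, z, w`, has the
pair symmetry of a curvature tensor (`IsNaturallyReductivePair.pair_symm`): this follows from the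
skew symmetry of `ad h` and of `y ↦ [x, y]_m` together with the Jacobi identity. Invariance under
`ad` is then a case distinction (`IsNaturallyReductivePair.form_skew`), and the form is
nondegenerate as soon as no nonzero element of `h ∩ (m + [m, m])` centralizes `m`
(`IsNaturallyReductivePair.form_nondegenerate`). Such an element would also centralize the ideal
`m + [m, m]`, whose analytic subgroup is transitive, so its one-parameter group would fix every
point of `M`; almost effectiveness excludes this (`eq_zero_of_isAlmostEffective`).

Part (2). If `m = h^⊥` for an invariant form `Q` on `g`, then the restriction of `Q` to `m`,
transported to `T_o M`, is invariant under the isotropy group and therefore extends to a unique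
invariant metric (`exists_isInvariant`); its smoothness comes from smooth local sections of the
orbit map (`exists_local_section`). Natural reductivity is the `ad`-invariance of `Q`. The
`Q`-orthogonal complement of `m + [m, m]` is an ideal contained in `h`, hence zero by
almost effectiveness (`addBracket_orthogonal_eq_top`).

The Lie theory this needs is developed from the definition of the bracket by left-invariant vector
fields: one-parameter subgroups exist (`exists_isOneParameterSubgroup`), the derivative of `Ad`
along them is the bracket (`hasDerivAt_Ad_apply`), the Lie algebra of the isotropy group is the
kernel of `g → T_o M` (`mem_isotropyAlgebra_iff`), and the analytic subgroup of an ideal that is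
mapped onto `T_o M` is transitive on the connected manifold `M`
(`isPretransitive_analyticSubgroup`). The smoothness of the exponential map is not used; products
of one-parameter subgroups take its place (`exists_smooth_map_of_linearMap`).

A tangent space is definitionally the model vector space. Many statements are ascribed to the
model space in order to use its norm.
-/

noncomputable section

namespace NaturallyReductive

/-! ### Kostant's form on `m + [m, m]` -/

section KostantForm

variable {L : Type*} [LieRing L] [LieAlgebra ℝ L]

/-- The subspace `m + [m, m]` of an abstract Lie algebra; for the Lie algebra of a Lie group this
is `addBracket`. -/
def lieAddBracket (m : Submodule ℝ L) : Submodule ℝ L :=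
  m ⊔ Submodule.span ℝ {z | ∃ x ∈ m, ∃ y ∈ m, ⁅x, y⁆ = z}

theorem le_lieAddBracket (m : Submodule ℝ L) : m ≤ lieAddBracket m := le_sup_left

theorem lie_mem_lieAddBracket {m : Submodule ℝ L} {x y : L} (hx : x ∈ m) (hy : y ∈ m) :
    ⁅x, y⁆ ∈ lieAddBracket m :=
  le_sup_right (a := m) (Submodule.subset_span ⟨x, hx, y, hy, rfl⟩)

theorem lieAddBracket_induction {m : Submodule ℝ L} {p : (u : L) → u ∈ lieAddBracket m → Prop}
    (mem : ∀ x (hx : x ∈ m), p x (le_lieAddBracket m hx))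
    (lie : ∀ x (hx : x ∈ m) y (hy : y ∈ m), p ⁅x, y⁆ (lie_mem_lieAddBracket hx hy))
    (add : ∀ u v hu hv, p u hu → p v hv → p (u + v) (add_mem hu hv))
    (smul : ∀ (c : ℝ) u hu, p u hu → p (c • u) (Submodule.smul_mem _ c hu)) {u : L}
    (hu : u ∈ lieAddBracket m) : p u hu := by
  have hspan {s : L} (hs : s ∈ Submodule.span ℝ {z | ∃ x ∈ m, ∃ y ∈ m, ⁅x, y⁆ = z}) :
      ∃ h : s ∈ lieAddBracket m, p s h := by
    induction hs using Submodule.span_induction with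
    | mem z hz =>
      obtain ⟨x, hx, y, hy, rfl⟩ := hz
      exact ⟨_, lie x hx y hy⟩
    | zero => exact ⟨_, mem 0 m.zero_mem⟩
    | add u v _ _ hu hv => exact ⟨_, add _ _ hu.1 hv.1 hu.2 hv.2⟩
    | smul c u _ hu => exact ⟨_, smul c _ hu.1 hu.2⟩
  obtain ⟨x, hx, s, hs, rfl⟩ := Submodule.mem_sup.1 hu
  exact add _ _ _ _ (mem x hx) (hspan hs).2

/-- If `g = m + h` with `[h, m] ⊆ m`, then `m + [m, m]` is an ideal. -/
theorem lie_mem_lieAddBracket_of_codisjoint {h m : Submodule ℝ L} (hc : m ⊔ h = ⊤)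
    (hm : ∀ a ∈ h, ∀ x ∈ m, ⁅a, x⁆ ∈ m) (u : L) {v : L} (hv : v ∈ lieAddBracket m) :
    ⁅u, v⁆ ∈ lieAddBracket m := by
  have key (u : L) (x : L) (hx : x ∈ m) : ⁅u, x⁆ ∈ lieAddBracket m := by
    obtain ⟨y, hy, a, ha, rfl⟩ := Submodule.mem_sup.1 (hc ▸ Submodule.mem_top : u ∈ m ⊔ h)
    rw [add_lie]
    exact add_mem (lie_mem_lieAddBracket hy hx) (le_lieAddBracket m (hm a ha x hx))
  have key₂ (y : L) (hy : y ∈ m) (v : L) (hv : v ∈ lieAddBracket m) :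
      ⁅v, y⁆ ∈ lieAddBracket m := key v y hy
  have key₃ (a : L) (ha : a ∈ h) (v : L) (hv : v ∈ lieAddBracket m) :
      ⁅a, v⁆ ∈ lieAddBracket m := by
    induction hv using lieAddBracket_induction with
    | mem x hx => exact key a x hx
    | lie x hx y hy =>
      rw [leibniz_lie]
      exact add_mem (lie_mem_lieAddBracket (hm a ha x hx) hy)
        (lie_mem_lieAddBracket hx (hm a ha y hy))
    | add u v _ _ hu hv => rw [lie_add]; exact add_mem hu hv
    | smul c u _ hu => rw [lie_smul]; exact Submodule.smul_mem _ c hu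
  obtain ⟨y, hy, a, ha, rfl⟩ := Submodule.mem_sup.1 (hc ▸ Submodule.mem_top : u ∈ m ⊔ h)
  rw [add_lie]
  refine add_mem ?_ (key₃ a ha v hv)
  rw [← lie_skew]
  exact neg_mem (key₂ y hy v hv)

/-- The infinitesimal data of a naturally reductive space: a reductive decomposition `g = m ⊕ h`
and a symmetric bilinear form `B` with radical `h`, for which `h` and the `m`-components of
brackets with elements of `m` act on `m` by skew maps. As `B` vanishes on `h`, no projection to `m`
appears in `skew_m`. -/
structure IsNaturallyReductivePair (h m : Submodule ℝ L) (B : LinearMap.BilinForm ℝ L) : Prop where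
  isCompl : IsCompl m h
  lie_h_m : ∀ a ∈ h, ∀ x ∈ m, ⁅a, x⁆ ∈ m
  lie_h_h : ∀ a ∈ h, ∀ b ∈ h, ⁅a, b⁆ ∈ h
  symm : ∀ x y, B x y = B y x
  apply_h : ∀ a ∈ h, ∀ x, B a x = 0
  skew_m : ∀ x ∈ m, ∀ y ∈ m, ∀ z ∈ m, B ⁅x, y⁆ z + B y ⁅x, z⁆ = 0
  skew_h : ∀ a ∈ h, ∀ y ∈ m, ∀ z ∈ m, B ⁅a, y⁆ z + B y ⁅a, z⁆ = 0
  nondegenerate : ∀ x ∈ m, (∀ y ∈ m, B x y = 0) → x = 0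

/-- A function of four variables that is skew in the first and in the last pair, and whose first
Bianchi sum is minus that of a function `N` which is skew in the first pair and symmetric under
exchange of the pairs, has the pair symmetry of a curvature tensor. -/
theorem pair_symm_of_bianchi {V : Type*} {m : Set V} (K N : V → V → V → V → ℝ)
    (hK₁ : ∀ x ∈ m, ∀ y ∈ m, ∀ z ∈ m, ∀ w ∈ m, K x y z w = -K y x z w)
    (hK₂ : ∀ x ∈ m, ∀ y ∈ m, ∀ z ∈ m, ∀ w ∈ m, K x y z w = -K x y w z)
    (hN₁ : ∀ x ∈ m, ∀ y ∈ m, ∀ z ∈ m, ∀ w ∈ m, N x y z w = -N y x z w)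
    (hN₂ : ∀ x ∈ m, ∀ y ∈ m, ∀ z ∈ m, ∀ w ∈ m, N x y z w = N z w x y)
    (hb : ∀ x ∈ m, ∀ y ∈ m, ∀ z ∈ m, ∀ w ∈ m, K x y z w + K y z x w + K z x y w =
      -(N x y z w + N y z x w + N z x y w))
    {x y z w : V} (hx : x ∈ m) (hy : y ∈ m) (hz : z ∈ m) (hw : w ∈ m) :
    K x y z w = K z w x y := by
  -- As for curvature tensors, one combines the four Bianchi sums in which the last argument is
  -- `w`, `x`, `y`, `z`. The contributions of `N` cancel.
  have b₁ := hb x hx y hy z hz w hw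
  have b₂ := hb y hy z hz w hw x hx
  have b₃ := hb z hz w hw x hx y hy
  have b₄ := hb w hw x hx y hy z hz
  have hN₃ (x) (hx : x ∈ m) (y) (hy : y ∈ m) (z) (hz : z ∈ m) (w) (hw : w ∈ m) :
      N x y z w = -N x y w z := by
    rw [hN₂ x hx y hy z hz w hw, hN₁ z hz w hw x hx y hy, hN₂ w hw z hz x hx y hy]
  -- Normalize the order inside the pairs.
  have := hK₁ y hy x hx z hz w hw
  have := hK₂ x hx y hy w hw z hz
  have := hK₁ z hz x hx y hy w hw
  have := hK₂ x hx z hz w hw y hy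
  have := hK₂ y hy z hz w hw x hx
  have := hK₁ w hw y hy z hz x hx
  have := hK₂ y hy w hw z hz x hx
  have := hK₂ z hz w hw y hy x hx
  have := hK₁ w hw x hx z hz y hy
  have := hK₂ x hx w hw z hz y hy
  have := hK₁ w hw x hx y hy z hz
  have := hK₁ y hy w hw x hx z hz
  have := hN₁ y hy x hx z hz w hw
  have := hN₃ x hx y hy w hw z hz
  have := hN₁ z hz x hx y hy w hw
  have := hN₃ x hx z hz w hw y hy
  have := hN₃ y hy z hz w hw x hx
  have := hN₁ w hw y hy z hz x hx
  have := hN₃ y hy w hw z hz x hx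
  have := hN₃ z hz w hw y hy x hx
  have := hN₁ w hw x hx z hz y hy
  have := hN₃ x hx w hw z hz y hy
  have := hN₁ w hw x hx y hy z hz
  have := hN₁ y hy w hw x hx z hz
  have := hN₂ x hx y hy z hz w hw
  have := hN₂ y hy z hz x hx w hw
  have := hN₂ x hx z hz y hy w hw
  linarith

namespace IsNaturallyReductivePair

variable {h m : Submodule ℝ L} {B : LinearMap.BilinForm ℝ L}

/-- The projection to `h` along `m`. -/
def projH (H : IsNaturallyReductivePair h m B) : L →ₗ[ℝ] L := h.projection m H.isCompl.symm

theorem projH_mem (H : IsNaturallyReductivePair h m B) (u : L) : H.projH u ∈ h :=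
  Submodule.projection_apply_mem _ u

theorem projH_of_mem_h (H : IsNaturallyReductivePair h m B) {a : L} (ha : a ∈ h) :
    H.projH a = a :=
  Submodule.projection_apply_left H.isCompl.symm ⟨a, ha⟩

theorem projH_of_mem_m (H : IsNaturallyReductivePair h m B) {x : L} (hx : x ∈ m) :
    H.projH x = 0 :=
  (Submodule.projection_apply_eq_zero_iff H.isCompl.symm).2 hx

theorem sub_projH_mem (H : IsNaturallyReductivePair h m B) (u : L) : u - H.projH u ∈ m := by
  rw [← Submodule.projection_apply_eq_zero_iff H.isCompl.symm]
  change H.projH (u - H.projH u) = 0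
  rw [map_sub, H.projH_of_mem_h (H.projH_mem u), sub_self]

theorem apply_h_right (H : IsNaturallyReductivePair h m B) (x : L) {a : L} (ha : a ∈ h) :
    B x a = 0 := by rw [H.symm, H.apply_h a ha]

theorem projH_mem_lieAddBracket (H : IsNaturallyReductivePair h m B) {u : L}
    (hu : u ∈ lieAddBracket m) : H.projH u ∈ lieAddBracket m := by
  have := sub_mem hu (le_lieAddBracket m (H.sub_projH_mem u))
  rwa [sub_sub_cancel] at this

/-- Kostant's identity: `⟨[[x, y]_h, z], w⟩` has the symmetry of a curvature tensor under the
exchange of `(x, y)` with `(z, w)`. -/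
theorem pair_symm (H : IsNaturallyReductivePair h m B) {x y z w : L} (hx : x ∈ m) (hy : y ∈ m)
    (hz : z ∈ m) (hw : w ∈ m) :
    B ⁅H.projH ⁅x, y⁆, z⁆ w = B ⁅H.projH ⁅z, w⁆, x⁆ y := by
  have hsk (x y : L) : H.projH ⁅x, y⁆ = -H.projH ⁅y, x⁆ := by rw [← map_neg, lie_skew]
  have hq (x y : L) : ⁅x, y⁆ - H.projH ⁅x, y⁆ = -(⁅y, x⁆ - H.projH ⁅y, x⁆) := by
    rw [hsk, ← lie_skew x y]; abel
  refine pair_symm_of_bianchi (m := (m : Set L)) (fun x y z w ↦ B ⁅H.projH ⁅x, y⁆, z⁆ w)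
    (fun x y z w ↦ B (⁅x, y⁆ - H.projH ⁅x, y⁆) (⁅z, w⁆ - H.projH ⁅z, w⁆)) ?_ ?_ ?_ ?_ ?_
    hx hy hz hw
  · intro x _ y _ z _ w _
    rw [hsk, neg_lie, map_neg, LinearMap.neg_apply]
  · intro x _ y _ z hz w hw
    have := H.skew_h _ (H.projH_mem ⁅x, y⁆) z hz w hw
    rw [H.symm ⁅_, w⁆ z]
    linarith
  · intro x _ y _ z _ w _
    rw [hq x y, map_neg, LinearMap.neg_apply]
  · intro x _ y _ z _ w _
    exact H.symm _ _
  · intro x hx y hy z hz w hw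
    have hN (x y z : L) (hz : z ∈ m) : B ⁅⁅x, y⁆ - H.projH ⁅x, y⁆, z⁆ w =
        B (⁅x, y⁆ - H.projH ⁅x, y⁆) (⁅z, w⁆ - H.projH ⁅z, w⁆) := by
      have h₁ := H.skew_m z hz _ (H.sub_projH_mem ⁅x, y⁆) w hw
      rw [← lie_skew, map_neg, LinearMap.neg_apply, map_sub (B _),
        H.apply_h_right _ (H.projH_mem _)]
      linarith
    have hj : ⁅⁅x, y⁆, z⁆ + ⁅⁅y, z⁆, x⁆ + ⁅⁅z, x⁆, y⁆ = 0 := by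
      rw [← neg_eq_zero, ← lie_jacobi x y z, ← lie_skew ⁅x, y⁆, ← lie_skew ⁅y, z⁆,
        ← lie_skew ⁅z, x⁆]
      abel
    have hj' : B (⁅⁅x, y⁆, z⁆ + ⁅⁅y, z⁆, x⁆ + ⁅⁅z, x⁆, y⁆) w = 0 := by
      rw [hj, map_zero, LinearMap.zero_apply]
    rw [← hN x y z hz, ← hN y z x hx, ← hN z x y hy]
    simp only [sub_lie, map_sub, map_add, LinearMap.add_apply, LinearMap.sub_apply] at hj' ⊢
    linarith

/-- The map `Σ cᵢ (xᵢ, yᵢ) ↦ Σ cᵢ [xᵢ, yᵢ]_h` from formal combinations of pairs in `m`, whose range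
is `h ∩ (m + [m, m])`. -/
def pairBracket (H : IsNaturallyReductivePair h m B) : (m × m →₀ ℝ) →ₗ[ℝ] L :=
  Finsupp.linearCombination ℝ fun p : m × m ↦ H.projH ⁅(p.1 : L), (p.2 : L)⁆

/-- The pairing `(Σ cᵢ (xᵢ, yᵢ), a) ↦ Σ cᵢ ⟨[a, xᵢ], yᵢ⟩`, written with `[a, x] = -ad x a`. -/
def pairForm (_H : IsNaturallyReductivePair h m B) : (m × m →₀ ℝ) →ₗ[ℝ] L →ₗ[ℝ] ℝ :=
  Finsupp.linearCombination ℝ fun p : m × m ↦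
    -(B.flip p.2 ∘ₗ ((LieAlgebra.ad ℝ L) p.1 : L →ₗ[ℝ] L))

theorem pairForm_single (H : IsNaturallyReductivePair h m B) (p : m × m) (a : L) :
    H.pairForm (Finsupp.single p 1) a = B ⁅a, (p.1 : L)⁆ p.2 := by
  simp only [pairForm, Finsupp.linearCombination_single, one_smul, LinearMap.neg_apply,
    LinearMap.comp_apply, LieAlgebra.ad_apply]
  rw [LinearMap.BilinForm.flip_apply, ← lie_skew a, map_neg, LinearMap.neg_apply]

theorem pairBracket_single (H : IsNaturallyReductivePair h m B) (p : m × m) :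
    H.pairBracket (Finsupp.single p 1) = H.projH ⁅(p.1 : L), (p.2 : L)⁆ := by
  simp [pairBracket]

theorem pairForm_symm (H : IsNaturallyReductivePair h m B) (s t : m × m →₀ ℝ) :
    H.pairForm s (H.pairBracket t) = H.pairForm t (H.pairBracket s) := by
  have : H.pairForm.compl₂ H.pairBracket = (H.pairForm.compl₂ H.pairBracket).flip := by
    refine Finsupp.lhom_ext' fun p ↦ LinearMap.ext_ring (Finsupp.lhom_ext' fun q ↦
      LinearMap.ext_ring ?_)
    simp only [LinearMap.comp_apply, LinearMap.compl₂_apply, LinearMap.flip_apply,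
      Finsupp.lsingle_apply, pairForm_single, pairBracket_single]
    exact H.pair_symm q.1.2 q.2.2 p.1.2 p.2.2
  exact LinearMap.congr_fun (LinearMap.congr_fun this s) t

theorem mem_range_pairBracket (H : IsNaturallyReductivePair h m B) {a : L} (ha : a ∈ h)
    (ha' : a ∈ lieAddBracket m) : a ∈ LinearMap.range H.pairBracket := by
  rw [← H.projH_of_mem_h ha]
  clear ha
  induction ha' using lieAddBracket_induction with
  | mem x hx => rw [H.projH_of_mem_m hx]; exact zero_mem _
  | lie x hx y hy => exact ⟨Finsupp.single (⟨x, hx⟩, ⟨y, hy⟩) 1, H.pairBracket_single _⟩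
  | add u v _ _ hu hv => rw [map_add]; exact add_mem hu hv
  | smul c u _ hu => rw [map_smul]; exact Submodule.smul_mem _ c hu

theorem exists_section_pairBracket (H : IsNaturallyReductivePair h m B) :
    ∃ s : L →ₗ[ℝ] (m × m →₀ ℝ), ∀ a ∈ LinearMap.range H.pairBracket, H.pairBracket (s a) = a := by
  obtain ⟨s, hs⟩ := H.pairBracket.rangeRestrict.exists_rightInverse_of_surjective
    H.pairBracket.range_rangeRestrict
  obtain ⟨s', hs'⟩ := LinearMap.exists_extend s
  refine ⟨s', fun a ha ↦ ?_⟩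
  have h₁ : s' a = s ⟨a, ha⟩ := LinearMap.congr_fun hs' ⟨a, ha⟩
  rw [h₁]
  exact congrArg Subtype.val (LinearMap.congr_fun hs ⟨a, ha⟩)

/-- Kostant's form, as a bilinear form on the whole Lie algebra (only its restriction to
`m + [m, m]` is canonical): the sum of `B` and of `pairForm`, evaluated on the `h`-component of the
second argument and on a presentation of the `h`-component of the first one as a combination of
elements `[x, y]_h`. By `pairForm_symm` the choice of the presentation does not matter on
`m + [m, m]`. -/
theorem exists_form (H : IsNaturallyReductivePair h m B) :
    ∃ Q : LinearMap.BilinForm ℝ L,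
      (∀ x ∈ m, ∀ u, Q x u = B x u) ∧
      (∀ a ∈ h, ∀ x ∈ m, Q a x = 0) ∧
      (∀ u ∈ lieAddBracket m, ∀ v ∈ lieAddBracket m, Q u v = Q v u) ∧
      (∀ a ∈ h ⊓ lieAddBracket m, ∀ x ∈ m, ∀ y ∈ m, Q a ⁅x, y⁆ = B ⁅a, x⁆ y) := by
  obtain ⟨s, hs⟩ := H.exists_section_pairBracket
  let Q : LinearMap.BilinForm ℝ L := B + (H.pairForm ∘ₗ s).compl₁₂ H.projH H.projH
  have hQ (u v : L) : Q u v = B u v + H.pairForm (s (H.projH u)) (H.projH v) := rfl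
  have hP (u : L) (hu : u ∈ lieAddBracket m) : H.pairBracket (s (H.projH u)) = H.projH u :=
    hs _ (H.mem_range_pairBracket (H.projH_mem u) (H.projH_mem_lieAddBracket hu))
  refine ⟨Q, fun x hx u ↦ ?_, fun a ha x hx ↦ ?_, fun u hu v hv ↦ ?_, fun a ha x hx y hy ↦ ?_⟩
  · simp [hQ, H.projH_of_mem_m hx]
  · simp [hQ, H.projH_of_mem_m hx, H.apply_h a ha]
  · have h₁ := H.pairForm_symm (s (H.projH u)) (s (H.projH v))
    rw [hP u hu, hP v hv] at h₁
    rw [hQ, hQ, H.symm, h₁]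
  · have h₁ : H.projH ⁅x, y⁆ = H.pairBracket (Finsupp.single (⟨x, hx⟩, ⟨y, hy⟩) 1) :=
      (H.pairBracket_single (⟨x, hx⟩, ⟨y, hy⟩)).symm
    rw [hQ, H.apply_h a ha.1, h₁, H.pairForm_symm, hP a ha.2, H.projH_of_mem_h ha.1,
      H.pairForm_single, zero_add]

/-- Kostant's form is `ad`-invariant on `m + [m, m]`. -/
theorem form_skew (H : IsNaturallyReductivePair h m B) {Q : LinearMap.BilinForm ℝ L}
    (hm : ∀ x ∈ m, ∀ u, Q x u = B x u) (hhm : ∀ a ∈ h, ∀ x ∈ m, Q a x = 0)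
    (hsymm : ∀ u ∈ lieAddBracket m, ∀ v ∈ lieAddBracket m, Q u v = Q v u)
    (hl : ∀ a ∈ h ⊓ lieAddBracket m, ∀ x ∈ m, ∀ y ∈ m, Q a ⁅x, y⁆ = B ⁅a, x⁆ y)
    {u v w : L} (hu : u ∈ lieAddBracket m) (hv : v ∈ lieAddBracket m)
    (hw : w ∈ lieAddBracket m) : Q ⁅u, v⁆ w + Q v ⁅u, w⁆ = 0 := by
  have hcod : m ⊔ h = ⊤ := H.isCompl.sup_eq_top
  have hid (u : L) {v : L} (hv : v ∈ lieAddBracket m) : ⁅u, v⁆ ∈ lieAddBracket m :=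
    lie_mem_lieAddBracket_of_codisjoint hcod H.lie_h_m u hv
  have hmk := le_lieAddBracket m
  -- It suffices to treat vectors that lie in `m` or in `h ∩ (m + [m, m])`.
  have split {p : L → Prop} (h₁ : ∀ x ∈ m, p x) (h₂ : ∀ a ∈ h ⊓ lieAddBracket m, p a)
      (hadd : ∀ u v, p u → p v → p (u + v)) {u : L} (hu : u ∈ lieAddBracket m) : p u := by
    rw [← sub_add_cancel u (H.projH u)]
    exact hadd _ _ (h₁ _ (H.sub_projH_mem u))
      (h₂ _ ⟨H.projH_mem u, H.projH_mem_lieAddBracket hu⟩)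
  have hadd₁ (v w u u' : L) (h₁ : Q ⁅u, v⁆ w + Q v ⁅u, w⁆ = 0)
      (h₂ : Q ⁅u', v⁆ w + Q v ⁅u', w⁆ = 0) :
      Q ⁅u + u', v⁆ w + Q v ⁅u + u', w⁆ = 0 := by
    simp only [add_lie, map_add, LinearMap.add_apply]; linarith
  have hadd₂ (u w v v' : L) (h₁ : Q ⁅u, v⁆ w + Q v ⁅u, w⁆ = 0)
      (h₂ : Q ⁅u, v'⁆ w + Q v' ⁅u, w⁆ = 0) :
      Q ⁅u, v + v'⁆ w + Q (v + v') ⁅u, w⁆ = 0 := by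
    simp only [lie_add, map_add, LinearMap.add_apply]; linarith
  have hadd₃ (u v w w' : L) (h₁ : Q ⁅u, v⁆ w + Q v ⁅u, w⁆ = 0)
      (h₂ : Q ⁅u, v⁆ w' + Q v ⁅u, w'⁆ = 0) :
      Q ⁅u, v⁆ (w + w') + Q v ⁅u, w + w'⁆ = 0 := by
    simp only [lie_add, map_add]; linarith
  have hmh (x : L) (hx : x ∈ m) (a : L) (ha : a ∈ h) : Q x a = 0 := by
    rw [hm x hx, H.apply_h_right x ha]
  have hswap (u v w : L) (hv : v ∈ lieAddBracket m) (hw : w ∈ lieAddBracket m)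
      (hs : Q ⁅u, v⁆ w + Q v ⁅u, w⁆ = 0) : Q ⁅u, w⁆ v + Q w ⁅u, v⁆ = 0 := by
    rw [hsymm _ (hid u hw) _ hv, hsymm _ hw _ (hid u hv), add_comm]; exact hs
  have hlie (a : L) (ha : a ∈ h ⊓ lieAddBracket m) (x : L) (hx : x ∈ m) : ⁅x, a⁆ ∈ m := by
    rw [← lie_skew]; exact neg_mem (H.lie_h_m a ha.1 x hx)
  have c₁ (x : L) (hx : x ∈ m) (y : L) (hy : y ∈ m) (a : L) (ha : a ∈ h ⊓ lieAddBracket m) :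
      Q ⁅x, y⁆ a + Q y ⁅x, a⁆ = 0 := by
    rw [hsymm _ (hid _ (hmk hy)) _ ha.2, hl a ha x hx y hy, hm y hy, ← lie_skew x, map_neg,
      H.symm y]
    ring
  have c₂ (a : L) (ha : a ∈ h ⊓ lieAddBracket m) (x : L) (hx : x ∈ m) (b : L)
      (hb : b ∈ h ⊓ lieAddBracket m) : Q ⁅a, x⁆ b + Q x ⁅a, b⁆ = 0 := by
    rw [hmh _ (H.lie_h_m a ha.1 x hx) _ hb.1, hmh x hx _ (H.lie_h_h a ha.1 b hb.1), add_zero]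
  -- For two elements of `h` both terms are given by `hl` when tested on brackets of elements
  -- of `m`, and the identity becomes the skewness of `ad a` on `m`.
  have c₃ (a : L) (ha : a ∈ h ⊓ lieAddBracket m) (b : L) (hb : b ∈ h ⊓ lieAddBracket m)
      (w : L) (hw : w ∈ lieAddBracket m) : Q ⁅a, b⁆ w + Q b ⁅a, w⁆ = 0 := by
    induction hw using lieAddBracket_induction with
    | mem x hx =>
      exact hswap _ _ _ (hmk hx) hb.2 (c₂ a ha x hx b hb)
    | lie x hx y hy =>
      have h₁ := H.skew_h a ha.1 ⁅b, x⁆ (H.lie_h_m b hb.1 x hx) y hy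
      rw [hl _ ⟨H.lie_h_h a ha.1 b hb.1, hid a hb.2⟩ x hx y hy, leibniz_lie a x y, map_add,
        hl b hb _ (H.lie_h_m a ha.1 x hx) y hy, hl b hb x hx _ (H.lie_h_m a ha.1 y hy),
        lie_lie, map_sub, LinearMap.sub_apply]
      linarith
    | add w w' _ _ h₁ h₂ => exact hadd₃ _ _ _ _ h₁ h₂
    | smul c w _ h₁ =>
      rw [lie_smul, map_smul, map_smul, ← smul_add, h₁, smul_zero]
  refine split (p := fun u ↦ Q ⁅u, v⁆ w + Q v ⁅u, w⁆ = 0) ?_ ?_ (hadd₁ v w) hu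
  · intro x hx
    refine split (p := fun v ↦ Q ⁅x, v⁆ w + Q v ⁅x, w⁆ = 0) ?_ ?_ (hadd₂ x w) hv
    · intro y hy
      refine split (p := fun w ↦ Q ⁅x, y⁆ w + Q y ⁅x, w⁆ = 0) ?_ (c₁ x hx y hy) (hadd₃ x y) hw
      intro z hz
      rw [hsymm _ (hid _ (hmk hy)) _ (hmk hz), hm z hz, hm y hy, H.symm z]
      exact H.skew_m x hx y hy z hz
    · intro a ha
      refine split (p := fun w ↦ Q ⁅x, a⁆ w + Q a ⁅x, w⁆ = 0) ?_ ?_ (hadd₃ x a) hw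
      · intro z hz
        exact hswap _ _ _ (hmk hz) ha.2 (c₁ x hx z hz a ha)
      · intro b hb
        rw [hmh _ (hlie a ha x hx) b hb.1, hhm a ha.1 _ (hlie b hb x hx), add_zero]
  · intro a ha
    refine split (p := fun v ↦ Q ⁅a, v⁆ w + Q v ⁅a, w⁆ = 0) ?_ ?_ (hadd₂ a w) hv
    · intro y hy
      refine split (p := fun w ↦ Q ⁅a, y⁆ w + Q y ⁅a, w⁆ = 0) ?_ (c₂ a ha y hy) (hadd₃ a y) hw
      intro z hz
      rw [hm _ (H.lie_h_m a ha.1 y hy), hm y hy]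
      exact H.skew_h a ha.1 y hy z hz
    · exact fun b hb ↦ c₃ a ha b hb w hw

/-- Kostant's form is nondegenerate if no element of `h ∩ (m + [m, m])` centralizes `m`. -/
theorem form_nondegenerate (H : IsNaturallyReductivePair h m B) {Q : LinearMap.BilinForm ℝ L}
    (hm : ∀ x ∈ m, ∀ u, Q x u = B x u) (hhm : ∀ a ∈ h, ∀ x ∈ m, Q a x = 0)
    (hl : ∀ a ∈ h ⊓ lieAddBracket m, ∀ x ∈ m, ∀ y ∈ m, Q a ⁅x, y⁆ = B ⁅a, x⁆ y)
    (hf : ∀ a ∈ h ⊓ lieAddBracket m, (∀ x ∈ m, ⁅a, x⁆ = 0) → a = 0)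
    {u : L} (hu : u ∈ lieAddBracket m) (h0 : ∀ v ∈ lieAddBracket m, Q u v = 0) : u = 0 := by
  obtain ⟨x, hx, a, ha, rfl⟩ : ∃ x ∈ m, ∃ a ∈ h ⊓ lieAddBracket m, x + a = u :=
    ⟨_, H.sub_projH_mem u, _, ⟨H.projH_mem u, H.projH_mem_lieAddBracket hu⟩, sub_add_cancel _ _⟩
  have hx0 : x = 0 := by
    refine H.nondegenerate x hx fun y hy ↦ ?_
    have := h0 y (le_lieAddBracket m hy)
    rwa [map_add, LinearMap.add_apply, hhm a ha.1 y hy, add_zero, hm x hx] at this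
  subst hx0
  rw [zero_add]
  refine hf a ha fun x hx ↦ H.nondegenerate _ (H.lie_h_m a ha.1 x hx) fun y hy ↦ ?_
  rw [← hl a ha x hx y hy, ← h0 _ (lie_mem_lieAddBracket hx hy), zero_add]

end IsNaturallyReductivePair

/-- An `ad`-invariant form on `m + [m, m]` for which `m` is isotropic and orthogonal to a
complement `h` vanishes. -/
theorem form_eq_zero {h m : Submodule ℝ L} (hc : m ⊔ h = ⊤)
    {D : lieAddBracket m → lieAddBracket m → ℝ}
    (hadd : ∀ u u' v, D (u + u') v = D u v + D u' v)
    (hadd' : ∀ u v v', D u (v + v') = D u v + D u v')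
    (hsmul : ∀ (c : ℝ) u v, D (c • u) v = c * D u v)
    (hsymm : ∀ u v, D u v = D v u)
    (hskew : ∀ x, x ∈ m → ∀ (v w : lieAddBracket m) (h₁ : ⁅x, (v : L)⁆ ∈ lieAddBracket m)
      (h₂ : ⁅x, (w : L)⁆ ∈ lieAddBracket m), D ⟨_, h₁⟩ w + D v ⟨_, h₂⟩ = 0)
    (hid : ∀ x ∈ m, ∀ v ∈ lieAddBracket m, ⁅x, v⁆ ∈ lieAddBracket m)
    (hhm : ∀ u v : lieAddBracket m, (u : L) ∈ h → (v : L) ∈ m → D u v = 0)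
    (hmm : ∀ u v : lieAddBracket m, (u : L) ∈ m → (v : L) ∈ m → D u v = 0)
    (u v : lieAddBracket m) : D u v = 0 := by
  have hm (u v : lieAddBracket m) (hu : (u : L) ∈ m) : D u v = 0 := by
    obtain ⟨x, hx, a, ha, he⟩ := Submodule.mem_sup.1 (hc ▸ Submodule.mem_top : (v : L) ∈ m ⊔ h)
    have ha' : a ∈ lieAddBracket m := by
      rw [← sub_eq_iff_eq_add'.2 he.symm]
      exact sub_mem v.2 (le_lieAddBracket m hx)
    have hv : v = ⟨x, le_lieAddBracket m hx⟩ + ⟨a, ha'⟩ := Subtype.ext he.symm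
    rw [hv, hadd', hmm _ _ hu hx, hsymm u, hhm _ _ ha hu, zero_add]
  obtain ⟨u, hu⟩ := u
  induction hu using lieAddBracket_induction with
  | mem x hx => exact hm _ _ hx
  | lie x hx y hy =>
    have h₁ := hskew x hx ⟨y, le_lieAddBracket m hy⟩ v (lie_mem_lieAddBracket hx hy)
      (hid x hx v v.2)
    rwa [hm ⟨y, _⟩ _ hy, add_zero] at h₁
  | add u u' h₁ h₂ e₁ e₂ =>
    refine (hadd ⟨u, h₁⟩ ⟨u', h₂⟩ v).trans ?_
    rw [e₁, e₂, add_zero]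
  | smul c u h₁ e₁ =>
    refine (hsmul c ⟨u, h₁⟩ v).trans ?_
    rw [e₁, mul_zero]

end KostantForm

/-! ### The adjoint representation in a chart -/

section Calculus

open Filter Topology VectorField

variable {E : Type*} [NormedAddCommGroup E] [NormedSpace ℝ E]

/-- Let `μ` be the multiplication and `κ (a, b) = a b a⁻¹` the conjugation of a Lie group in a chart
around the identity `e`. Differentiating `μ (a, b) = μ (κ (a, b), a)` first in `b` and then in `a`
shows that the derivative at `e` of the adjoint representation is the bracket of left-invariant
vector fields. -/
theorem hasFDerivAt_conj_of_local_group {μ κ : E × E → E} {e : E} (hμ : ContDiffAt ℝ 2 μ (e, e))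
    (hκ : ContDiffAt ℝ 2 κ (e, e)) (hr : ∀ᶠ a in 𝓝 e, μ (a, e) = a)
    (hl : ∀ᶠ b in 𝓝 e, μ (e, b) = b) (hκe : ∀ᶠ a in 𝓝 e, κ (a, e) = e)
    (hc : ∀ᶠ p in 𝓝 (e, e), μ p = μ (κ p, p.1)) (w : E) :
    ∃ T : E →L[ℝ] E, HasFDerivAt (fun a ↦ fderiv ℝ κ (a, e) (0, w)) T e ∧
      ∀ v, T v = lieBracket ℝ (fun a ↦ fderiv ℝ μ (a, e) (0, v))
        (fun a ↦ fderiv ℝ μ (a, e) (0, w)) e := by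
  have hDμ : DifferentiableAt ℝ (fderiv ℝ μ) (e, e) :=
    (hμ.fderiv_right (m := 1) (by norm_num)).differentiableAt (by norm_num)
  have hDκ : DifferentiableAt ℝ (fderiv ℝ κ) (e, e) :=
    (hκ.fderiv_right (m := 1) (by norm_num)).differentiableAt (by norm_num)
  set B := fderiv ℝ (fderiv ℝ μ) (e, e) with hB
  have hBs (p q : E × E) : B p q = B q p :=
    (hμ.isSymmSndFDerivAt (by simp)) p q
  have hi₁ : HasFDerivAt (fun a : E ↦ (a, e)) (.inl ℝ E E) e := by
    exact (hasFDerivAt_id e).prodMk (hasFDerivAt_const e e)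
  have hi₂ : HasFDerivAt (fun a : E ↦ (e, a)) (.inr ℝ E E) e := by
    exact (hasFDerivAt_const e e).prodMk (hasFDerivAt_id e)
  have hV (w : E) : HasFDerivAt (fun a ↦ fderiv ℝ μ (a, e) (0, w))
      ((ContinuousLinearMap.apply ℝ E ((0 : E), w)).comp (B.comp (.inl ℝ E E))) e :=
    (ContinuousLinearMap.apply ℝ E ((0 : E), w)).hasFDerivAt.comp e
      (hDμ.hasFDerivAt.comp (f := fun a : E ↦ (a, e)) e hi₁)
  have hF : DifferentiableAt ℝ (fun a ↦ fderiv ℝ κ (a, e) (0, w)) e :=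
    (ContinuousLinearMap.apply ℝ E ((0 : E), w)).differentiableAt.comp e
      (DifferentiableAt.comp e hDκ hi₁.differentiableAt)
  have hdμ : ∀ᶠ p in 𝓝 (e, e), DifferentiableAt ℝ μ p :=
    (hμ.eventually (by simp)).mono fun p hp ↦ hp.differentiableAt (by norm_num)
  have hdκ : ∀ᶠ p in 𝓝 (e, e), DifferentiableAt ℝ κ p :=
    (hκ.eventually (by simp)).mono fun p hp ↦ hp.differentiableAt (by norm_num)
  have hμ₁ (u : E) : fderiv ℝ μ (e, e) (u, 0) = u := by
    have h₁ := hdμ.self_of_nhds.hasFDerivAt.comp (f := fun a : E ↦ (a, e)) e hi₁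
    have h₂ := (hasFDerivAt_id (𝕜 := ℝ) e).congr_of_eventuallyEq (f₁ := fun a ↦ μ (a, e)) hr
    simpa using DFunLike.congr_fun (h₁.unique h₂) u
  have hμ₂ (u : E) : fderiv ℝ μ (e, e) (0, u) = u := by
    have h₁ := hdμ.self_of_nhds.hasFDerivAt.comp e hi₂
    have h₂ := (hasFDerivAt_id (𝕜 := ℝ) e).congr_of_eventuallyEq (f₁ := fun a ↦ μ (e, a)) hl
    simpa using DFunLike.congr_fun (h₁.unique h₂) u
  have hid : ∀ᶠ a in 𝓝 e, fderiv ℝ μ (a, e) (0, w) =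
      fderiv ℝ μ (e, a) (fderiv ℝ κ (a, e) (0, w), 0) := by
    have hc' : ∀ᶠ a in 𝓝 e, ∀ᶠ p in 𝓝 (a, e), μ p = μ (κ p, p.1) :=
      hi₁.continuousAt.eventually hc.eventually_nhds
    filter_upwards [hc', hκe, hi₁.continuousAt.eventually hdμ, hi₁.continuousAt.eventually hdκ,
      hi₂.continuousAt.eventually hdμ] with a h₁ h₂ h₃ h₄ h₅
    have hj : HasFDerivAt (fun b : E ↦ (a, b)) (.inr ℝ E E) e :=
      (hasFDerivAt_const a e).prodMk (hasFDerivAt_id e)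
    have h₆ := h₃.hasFDerivAt.comp e hj
    have h₇ := (h₄.hasFDerivAt.comp e hj).prodMk (hasFDerivAt_const a e)
    have h₈ : HasFDerivAt μ (fderiv ℝ μ (e, a)) (κ (a, e), a) := by
      rw [h₂]; exact h₅.hasFDerivAt
    have h₉ := h₈.comp e h₇
    have h₁₀ : (fun b ↦ μ (a, b)) =ᶠ[𝓝 e] fun b ↦ μ (κ (a, b), a) :=
      hj.continuousAt.eventually h₁
    simpa using DFunLike.congr_fun (h₆.unique (h₉.congr_of_eventuallyEq h₁₀)) w
  have hFe : fderiv ℝ κ (e, e) (0, w) = w := by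
    have := hid.self_of_nhds
    rw [hμ₁, hμ₂] at this
    exact this.symm
  refine ⟨_, hF.hasFDerivAt, fun v ↦ ?_⟩
  have h₁ := (hDμ.hasFDerivAt.comp e hi₂).clm_apply
    (hF.hasFDerivAt.prodMk (hasFDerivAt_const (0 : E) e))
  have h₂ := DFunLike.congr_fun ((hV w).unique (h₁.congr_of_eventuallyEq hid)) v
  simp only [Function.comp_apply, ContinuousLinearMap.comp_apply, ContinuousLinearMap.inl_apply,
    ContinuousLinearMap.inr_apply, ContinuousLinearMap.apply_apply, add_apply,
    ContinuousLinearMap.flip_apply, ContinuousLinearMap.prod_apply,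
    zero_apply, hFe, hμ₁, ← hB] at h₂
  rw [lieBracket, (hV w).fderiv, (hV v).fderiv]
  simp only [ContinuousLinearMap.comp_apply, ContinuousLinearMap.inl_apply,
    ContinuousLinearMap.apply_apply, hμ₂, h₂]
  rw [hBs (0, v) (w, 0)]
  abel

end Calculus

section ChartDerivatives

open Filter Topology

variable {E₁ : Type*} [NormedAddCommGroup E₁] [NormedSpace ℝ E₁]
  {E₂ : Type*} [NormedAddCommGroup E₂] [NormedSpace ℝ E₂]
  {N : Type*} [TopologicalSpace N] [ChartedSpace E₁ N]
  {N' : Type*} [TopologicalSpace N'] [ChartedSpace E₂ N']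

theorem mfderiv_eq_fderiv_in_charts {f : N → N'} {x : N} {y : N'}
    (hf : MDifferentiableAt 𝓘(ℝ, E₁) 𝓘(ℝ, E₂) f x) (hy : f x = y) :
    (mfderiv 𝓘(ℝ, E₁) 𝓘(ℝ, E₂) f x : E₁ →L[ℝ] E₂) =
      fderiv ℝ (extChartAt 𝓘(ℝ, E₂) y ∘ f ∘ (extChartAt 𝓘(ℝ, E₁) x).symm)
        (extChartAt 𝓘(ℝ, E₁) x x) := by
  subst hy
  refine hf.mfderiv.trans ?_
  rw [modelWithCornersSelf_coe, Set.range_id, fderivWithin_univ]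
  rfl

variable [IsManifold 𝓘(ℝ, E₂) ∞ N']

theorem mfderiv_extChartAt_comp_mfderiv {f : N → N'} {x : N} {y : N'}
    (hf : MDifferentiableAt 𝓘(ℝ, E₁) 𝓘(ℝ, E₂) f x)
    (hy : f x ∈ (extChartAt 𝓘(ℝ, E₂) y).source) (v : E₁) :
    (mfderiv 𝓘(ℝ, E₂) 𝓘(ℝ, E₂) (extChartAt 𝓘(ℝ, E₂) y) (f x) : E₂ →L[ℝ] E₂)
        ((mfderiv 𝓘(ℝ, E₁) 𝓘(ℝ, E₂) f x : E₁ →L[ℝ] E₂) v) =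
      fderiv ℝ (extChartAt 𝓘(ℝ, E₂) y ∘ f ∘ (extChartAt 𝓘(ℝ, E₁) x).symm)
        (extChartAt 𝓘(ℝ, E₁) x x) v := by
  have : IsManifold 𝓘(ℝ, E₂) 1 N' := .of_le (n := ∞) (by simp)
  have hφ : MDifferentiableAt 𝓘(ℝ, E₂) 𝓘(ℝ, E₂) (extChartAt 𝓘(ℝ, E₂) y) (f x) :=
    mdifferentiableAt_extChartAt (by rwa [extChartAt_source] at hy)
  have h₁ := mfderiv_eq_fderiv_in_charts (hφ.comp x hf) rfl
  have h₂ := mfderiv_comp x hφ hf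
  exact (DFunLike.congr_fun h₂ v).symm.trans (DFunLike.congr_fun h₁ v)

end ChartDerivatives

section LieGroupChart

open Filter Topology VectorField

variable {E : Type*} [NormedAddCommGroup E] [NormedSpace ℝ E]
  {G : Type*} [TopologicalSpace G] [ChartedSpace E G] [Group G]

/-- The multiplication of `G` in the preferred chart at `1`. -/
def chartMul (E : Type*) [NormedAddCommGroup E] [NormedSpace ℝ E]
    (G : Type*) [TopologicalSpace G] [ChartedSpace E G] [Group G] (p : E × E) : E :=
  extChartAt 𝓘(ℝ, E) (1 : G)
    ((extChartAt 𝓘(ℝ, E) (1 : G)).symm p.1 * (extChartAt 𝓘(ℝ, E) (1 : G)).symm p.2)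

/-- The conjugation `(a, b) ↦ a * b * a⁻¹` of `G` in the preferred chart at `1`. -/
def chartConj (E : Type*) [NormedAddCommGroup E] [NormedSpace ℝ E]
    (G : Type*) [TopologicalSpace G] [ChartedSpace E G] [Group G] (p : E × E) : E :=
  extChartAt 𝓘(ℝ, E) (1 : G)
    ((extChartAt 𝓘(ℝ, E) (1 : G)).symm p.1 * (extChartAt 𝓘(ℝ, E) (1 : G)).symm p.2 *
      ((extChartAt 𝓘(ℝ, E) (1 : G)).symm p.1)⁻¹)

variable [LieGroup 𝓘(ℝ, E) ∞ G]

/-- The regularity for which `GroupLieAlgebra` is a Lie algebra. -/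
instance lieGroup_minSmoothness : LieGroup 𝓘(ℝ, E) (minSmoothness ℝ 3) G :=
  LieGroup.of_le (n := ∞) (by
    rw [minSmoothness_of_isRCLikeNormedField]
    exact WithTop.coe_le_coe.2 (le_top (a := (3 : ℕ∞))))

theorem contMDiffAt_chart_symm_comp {f : E × E → E} {p : E × E} (hf : ContDiff ℝ ∞ f)
    (hp : f p ∈ (extChartAt 𝓘(ℝ, E) (1 : G)).target) :
    ContMDiffAt 𝓘(ℝ, E × E) 𝓘(ℝ, E) ∞ (fun q ↦ (extChartAt 𝓘(ℝ, E) (1 : G)).symm (f q)) p :=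
  ((contMDiffOn_extChartAt_symm (1 : G)).contMDiffAt
    ((isOpen_extChartAt_target (I := 𝓘(ℝ, E)) (1 : G)).mem_nhds hp)).comp p
      hf.contMDiff.contMDiffAt

theorem contDiffAt_chartMul {a : E} (ha : a ∈ (extChartAt 𝓘(ℝ, E) (1 : G)).target) :
    ContDiffAt ℝ ∞ (chartMul E G) (a, extChartAt 𝓘(ℝ, E) (1 : G) 1) := by
  rw [← contMDiffAt_iff_contDiffAt]
  refine ContMDiffAt.comp (I' := 𝓘(ℝ, E)) (a, extChartAt 𝓘(ℝ, E) (1 : G) 1)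
    (contMDiffAt_extChartAt' ?_) ((contMDiffAt_chart_symm_comp contDiff_fst ha).mul
      (contMDiffAt_chart_symm_comp contDiff_snd (mem_extChartAt_target _)))
  rw [extChartAt_to_inv, mul_one, ← extChartAt_source 𝓘(ℝ, E)]
  exact (extChartAt 𝓘(ℝ, E) (1 : G)).map_target ha

theorem contDiffAt_chartConj {a : E} (ha : a ∈ (extChartAt 𝓘(ℝ, E) (1 : G)).target) :
    ContDiffAt ℝ ∞ (chartConj E G) (a, extChartAt 𝓘(ℝ, E) (1 : G) 1) := by
  rw [← contMDiffAt_iff_contDiffAt]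
  refine ContMDiffAt.comp (I' := 𝓘(ℝ, E)) (a, extChartAt 𝓘(ℝ, E) (1 : G) 1)
    (contMDiffAt_extChartAt' ?_) (((contMDiffAt_chart_symm_comp contDiff_fst ha).mul
      (contMDiffAt_chart_symm_comp contDiff_snd (mem_extChartAt_target _))).mul
      (contMDiffAt_chart_symm_comp contDiff_fst ha).inv)
  rw [extChartAt_to_inv, mul_one, mul_inv_cancel]
  exact mem_chart_source _ _

theorem mdifferentiableAt_conj (a b : G) :
    MDifferentiableAt 𝓘(ℝ, E) 𝓘(ℝ, E) (fun b : G ↦ a * b * a⁻¹) b :=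
  ((contMDiff_mul_right (I := 𝓘(ℝ, E)) (n := ∞) (a := a⁻¹)).comp
    (contMDiff_mul_left (a := a))).mdifferentiableAt (by simp)

theorem Ad_eq_fderiv_chartConj {a : G} (ha : a ∈ (extChartAt 𝓘(ℝ, E) (1 : G)).source) (w : E) :
    (Ad a : E →L[ℝ] E) w =
      fderiv ℝ (chartConj E G) (extChartAt 𝓘(ℝ, E) (1 : G) a, extChartAt 𝓘(ℝ, E) (1 : G) 1)
        (0, w) := by
  have h₁ : (Ad a : E →L[ℝ] E) = _ :=
    mfderiv_eq_fderiv_in_charts (mdifferentiableAt_conj a 1) (y := 1) (by simp)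
  have h₂ : extChartAt 𝓘(ℝ, E) (1 : G) ∘ (fun b : G ↦ a * b * a⁻¹) ∘
      (extChartAt 𝓘(ℝ, E) (1 : G)).symm =
      chartConj E G ∘ fun b ↦ (extChartAt 𝓘(ℝ, E) (1 : G) a, b) := by
    ext b
    simp only [chartConj, Function.comp_apply, (extChartAt 𝓘(ℝ, E) (1 : G)).left_inv ha]
  rw [h₁, h₂]
  have h₃ := (((contDiffAt_chartConj ((extChartAt 𝓘(ℝ, E) (1 : G)).map_source ha)).differentiableAt
    (by simp)).hasFDerivAt.comp (extChartAt 𝓘(ℝ, E) (1 : G) 1)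
    ((hasFDerivAt_const _ _).prodMk (hasFDerivAt_id _)))
  rw [h₃.fderiv]
  rfl

theorem mfderiv_extChartAt_mulInvariantVectorField {a : G}
    (ha : a ∈ (extChartAt 𝓘(ℝ, E) (1 : G)).source) (w : GroupLieAlgebra 𝓘(ℝ, E) G) :
    (mfderiv 𝓘(ℝ, E) 𝓘(ℝ, E) (extChartAt 𝓘(ℝ, E) (1 : G)) a : E →L[ℝ] E)
        (mulInvariantVectorField w a) =
      fderiv ℝ (chartMul E G) (extChartAt 𝓘(ℝ, E) (1 : G) a, extChartAt 𝓘(ℝ, E) (1 : G) 1)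
        ((0 : E), (w : E)) := by
  have h₀ : MDifferentiableAt 𝓘(ℝ, E) 𝓘(ℝ, E) (fun b : G ↦ a * b) 1 :=
    (contMDiff_mul_left (I := 𝓘(ℝ, E)) (n := ∞) (a := a)).mdifferentiableAt (by simp)
  have h₁ := mfderiv_extChartAt_comp_mfderiv (y := 1) h₀ (by simpa using ha) w
  have h₂ : extChartAt 𝓘(ℝ, E) (1 : G) ∘ (fun b : G ↦ a * b) ∘
      (extChartAt 𝓘(ℝ, E) (1 : G)).symm =
      chartMul E G ∘ fun b ↦ (extChartAt 𝓘(ℝ, E) (1 : G) a, b) := by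
    ext b
    simp only [chartMul, Function.comp_apply, (extChartAt 𝓘(ℝ, E) (1 : G)).left_inv ha]
  have h₃ := (((contDiffAt_chartMul ((extChartAt 𝓘(ℝ, E) (1 : G)).map_source ha)).differentiableAt
    (by simp)).hasFDerivAt.comp (extChartAt 𝓘(ℝ, E) (1 : G) 1)
    ((hasFDerivAt_const _ _).prodMk (hasFDerivAt_id _)))
  rw [h₂, h₃.fderiv] at h₁
  refine Eq.trans ?_ h₁
  rw [mul_one]
  rfl

/-- The bracket of the Lie algebra of `G` in the preferred chart at `1`. -/
theorem bracket_eq_lieBracket_chart (v w : GroupLieAlgebra 𝓘(ℝ, E) G) :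
    ⁅v, w⁆ = lieBracket ℝ
      (fun a ↦ fderiv ℝ (chartMul E G) (a, extChartAt 𝓘(ℝ, E) (1 : G) 1) ((0 : E), (v : E)))
      (fun a ↦ fderiv ℝ (chartMul E G) (a, extChartAt 𝓘(ℝ, E) (1 : G) 1) ((0 : E), (w : E)))
      (extChartAt 𝓘(ℝ, E) (1 : G) 1) := by
  have : IsManifold 𝓘(ℝ, E) 1 G := .of_le (n := ∞) (by simp)
  let V (v : GroupLieAlgebra 𝓘(ℝ, E) G) (a : E) : E :=
    mpullbackWithin 𝓘(ℝ, E) 𝓘(ℝ, E) (extChartAt 𝓘(ℝ, E) (1 : G)).symm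
      (mulInvariantVectorField v) (Set.range 𝓘(ℝ, E)) a
  have hV (v : GroupLieAlgebra 𝓘(ℝ, E) G) : V v =ᶠ[𝓝 (extChartAt 𝓘(ℝ, E) (1 : G) 1)]
      fun a ↦ fderiv ℝ (chartMul E G) (a, extChartAt 𝓘(ℝ, E) (1 : G) 1) ((0 : E), (v : E)) := by
    filter_upwards [extChartAt_target_mem_nhds (I := 𝓘(ℝ, E)) (1 : G)] with a ha
    have h₁ := mfderiv_extChartAt_mulInvariantVectorField
      ((extChartAt 𝓘(ℝ, E) (1 : G)).map_target ha) v
    rw [(extChartAt 𝓘(ℝ, E) (1 : G)).right_inv ha] at h₁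
    refine Eq.trans ?_ h₁
    change mpullbackWithin _ _ _ _ _ _ = _
    rw [mpullbackWithin_apply, ContinuousLinearMap.inverse_eq
      (mfderivWithin_extChartAt_symm_comp_mfderiv_extChartAt ha)
      (mfderiv_extChartAt_comp_mfderivWithin_extChartAt_symm ha)]
  rw [GroupLieAlgebra.bracket_def, ← mlieBracketWithin_univ, mlieBracketWithin_apply,
    mfderiv_extChartAt_self]
  refine (DFunLike.congr_fun (ContinuousLinearMap.inverse_id (R := ℝ) (M := E)) _).trans ?_
  have hs : (extChartAt 𝓘(ℝ, E) (1 : G)).symm ⁻¹' Set.univ ∩ Set.range 𝓘(ℝ, E) = Set.univ := by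
    simp
  have hb : lieBracketWithin ℝ (V v) (V w) Set.univ (extChartAt 𝓘(ℝ, E) (1 : G) 1) = _ :=
    (congrFun lieBracketWithin_univ _).trans ((hV v).lieBracket_vectorField_eq (hV w))
  rw [hs]
  exact hb

/-- The derivative of the adjoint representation along a curve through `1` is the bracket with the
velocity of the curve. -/
theorem hasDerivAt_Ad_apply {γ : ℝ → G} (hγ : MDifferentiableAt 𝓘(ℝ, ℝ) 𝓘(ℝ, E) γ 0)
    (hγ0 : γ 0 = 1) (w : GroupLieAlgebra 𝓘(ℝ, E) G) :
    HasDerivAt (F := E) (fun t ↦ (Ad (γ t) : E →L[ℝ] E) w)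
      (⁅velocity E γ, w⁆ : GroupLieAlgebra 𝓘(ℝ, E) G) 0 := by
  set φ := extChartAt 𝓘(ℝ, E) (1 : G) with hφ
  have hmem : φ 1 ∈ φ.target := mem_extChartAt_target _
  have htarget : φ.target ∈ 𝓝 (φ 1) := extChartAt_target_mem_nhds _
  have hs : φ.symm (φ 1) = 1 := extChartAt_to_inv _
  have htop : IsTopologicalGroup G := topologicalGroup_of_lieGroup 𝓘(ℝ, E) ∞
  have hμ := contDiffAt_chartMul (G := G) hmem
  have hκ := contDiffAt_chartConj (G := G) hmem
  have hcont : ContinuousAt φ.symm (φ 1) := continuousAt_extChartAt_symm _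
  have hcc : ContinuousAt (fun p : E × E ↦ φ.symm p.1 * φ.symm p.2 * (φ.symm p.1)⁻¹)
      (φ 1, φ 1) := by
    have h₁ : ContinuousAt (fun p : E × E ↦ φ.symm p.1) (φ 1, φ 1) :=
      ContinuousAt.comp (f := Prod.fst) (x := (φ 1, φ 1)) hcont continuousAt_fst
    have h₂ : ContinuousAt (fun p : E × E ↦ φ.symm p.2) (φ 1, φ 1) :=
      ContinuousAt.comp (f := Prod.snd) (x := (φ 1, φ 1)) hcont continuousAt_snd
    exact (h₁.mul h₂).mul h₁.inv
  have h2 : (2 : WithTop ℕ∞) ≤ ∞ := WithTop.coe_le_coe.2 (le_top (a := (2 : ℕ∞)))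
  obtain ⟨T, hT, hT'⟩ := hasFDerivAt_conj_of_local_group (hμ.of_le h2) (hκ.of_le h2)
    (by
      filter_upwards [htarget] with a ha
      simp only [chartMul, ← hφ, hs, mul_one, φ.right_inv ha])
    (by
      filter_upwards [htarget] with a ha
      simp only [chartMul, ← hφ, hs, one_mul, φ.right_inv ha])
    (by
      filter_upwards with a
      rw [chartConj, ← hφ, hs, mul_one, mul_inv_cancel])
    (by
      have : ∀ᶠ p in 𝓝 (φ 1, φ 1), φ.symm p.1 * φ.symm p.2 * (φ.symm p.1)⁻¹ ∈ φ.source := by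
        refine hcc.eventually (p := fun g ↦ g ∈ φ.source) ?_
        beta_reduce
        rw [hs, mul_one, mul_inv_cancel]
        exact extChartAt_source_mem_nhds _
      filter_upwards [this] with p hp
      simp only [chartMul, chartConj, ← hφ, φ.left_inv hp, inv_mul_cancel_right])
    (w : E)
  have hmd : MDifferentiableAt 𝓘(ℝ, E) 𝓘(ℝ, E) φ (γ 0) := by
    have : IsManifold 𝓘(ℝ, E) 1 G := .of_le (n := ∞) (by simp)
    rw [hγ0]
    exact mdifferentiableAt_extChartAt (mem_chart_source _ _)
  have hc : HasDerivAt (φ ∘ γ) (velocity E γ : E) 0 := by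
    have h₁ : DifferentiableAt ℝ (φ ∘ γ) 0 :=
      mdifferentiableAt_iff_differentiableAt.1 (hmd.comp 0 hγ)
    have h₂ := mfderiv_eq_fderiv_in_charts hγ hγ0
    have h₃ : velocity E γ = fderiv ℝ (φ ∘ γ) 0 1 := by
      exact DFunLike.congr_fun h₂ (1 : ℝ)
    rw [h₃]
    exact h₁.hasFDerivAt.hasDerivAt
  have hT'' : HasFDerivAt (fun a ↦ fderiv ℝ (chartConj E G) (a, φ 1) (0, (w : E))) T
      ((φ ∘ γ) 0) := by
    rw [Function.comp_apply, hγ0]; exact hT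
  have h₁ := hT''.comp_hasDerivAt (0 : ℝ) hc
  rw [bracket_eq_lieBracket_chart]
  refine HasDerivAt.congr_of_eventuallyEq (F := E) (h₁.congr_deriv (hT' _)) ?_
  have : ∀ᶠ t in 𝓝 (0 : ℝ), γ t ∈ φ.source := by
    refine hγ.continuousAt.eventually (p := fun g ↦ g ∈ φ.source) ?_
    rw [hγ0]
    exact extChartAt_source_mem_nhds _
  filter_upwards [this] with t ht
  exact Ad_eq_fderiv_chartConj ht w

end LieGroupChart

/-! ### Existence of one-parameter subgroups -/

section OneParameterSubgroups

open Filter Topology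

/-- Solutions of an autonomous ordinary differential equation with smooth right hand side are
smooth. -/
theorem contDiffAt_of_hasDerivAt_comp {E : Type*} [NormedAddCommGroup E] [NormedSpace ℝ E]
    {V : E → E} {c : ℝ → E} {t₀ : ℝ} (hV : ContDiffAt ℝ ∞ V (c t₀))
    (hc : ∀ᶠ t in 𝓝 t₀, HasDerivAt c (V (c t)) t) : ContDiffAt ℝ ∞ c t₀ := by
  rw [contDiffAt_infty]
  intro n
  induction n with
  | zero =>
    refine contDiffAt_zero.2 ⟨_, hc, fun t ht ↦ ?_⟩
    exact (HasDerivAt.continuousAt ht).continuousWithinAt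
  | succ n ih =>
    rw [Nat.cast_add, Nat.cast_one, contDiffAt_succ_iff_hasFDerivAt]
    refine ⟨fun t ↦ (1 : ℝ →L[ℝ] ℝ).smulRight (V (c t)), ⟨_, hc, fun t ht ↦ ?_⟩, ?_⟩
    · exact HasDerivAt.hasFDerivAt ht
    · exact contDiffAt_const.smulRight
        ((hV.of_le (WithTop.coe_le_coe.2 le_top)).comp t₀ ih)

variable {E : Type*} [NormedAddCommGroup E] [NormedSpace ℝ E]
  {G : Type*} [TopologicalSpace G] [ChartedSpace E G] [Group G] [LieGroup 𝓘(ℝ, E) ∞ G]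

theorem mdifferentiableAt_mul_left (a b : G) :
    MDifferentiableAt 𝓘(ℝ, E) 𝓘(ℝ, E) (fun g : G ↦ a * g) b :=
  (contMDiff_mul_left (I := 𝓘(ℝ, E)) (n := ∞) (a := a)).mdifferentiableAt (by simp)

theorem mfderiv_mul_left_mulInvariantVectorField (w : GroupLieAlgebra 𝓘(ℝ, E) G) (a b : G) :
    (mfderiv 𝓘(ℝ, E) 𝓘(ℝ, E) (fun g : G ↦ a * g) b : E →L[ℝ] E) (mulInvariantVectorField w b) =
      mulInvariantVectorField w (a * b) := by
  have h₁ : MDifferentiableAt 𝓘(ℝ, E) 𝓘(ℝ, E) (fun g : G ↦ a * g) (b * 1) :=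
    mdifferentiableAt_mul_left a _
  have h₂ := mfderiv_comp (1 : G) h₁ (mdifferentiableAt_mul_left b 1)
  have h₃ : (fun g : G ↦ a * g) ∘ (fun g : G ↦ b * g) = fun g ↦ a * b * g := by
    ext g; simp [mul_assoc]
  rw [h₃, mul_one] at h₂
  exact (DFunLike.congr_fun h₂ w).symm

theorem isMIntegralCurveOn_mul_left {γ : ℝ → G} {w : GroupLieAlgebra 𝓘(ℝ, E) G} {s : Set ℝ}
    (hγ : IsMIntegralCurveOn γ (mulInvariantVectorField (I := 𝓘(ℝ, E)) w) s) (a : G) :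
    IsMIntegralCurveOn (fun t ↦ a * γ t) (mulInvariantVectorField (I := 𝓘(ℝ, E)) w) s := by
  intro t ht
  have h₁ := (mdifferentiableAt_mul_left (E := E) a (γ t)).hasMFDerivAt.comp_hasMFDerivWithinAt t
    (hγ t ht)
  have h₂ : ((1 : ℝ →L[ℝ] ℝ).smulRight (mulInvariantVectorField w (a * γ t) : E) : ℝ →L[ℝ] E) =
      (mfderiv 𝓘(ℝ, E) 𝓘(ℝ, E) (fun g : G ↦ a * g) (γ t) : E →L[ℝ] E).comp
        ((1 : ℝ →L[ℝ] ℝ).smulRight (mulInvariantVectorField w (γ t) : E)) := by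
    refine ContinuousLinearMap.ext_ring ?_
    refine ((one_smul ℝ (_ : E)).trans ?_).trans (congrArg
      (mfderiv 𝓘(ℝ, E) 𝓘(ℝ, E) (fun g : G ↦ a * g) (γ t) : E →L[ℝ] E) (one_smul ℝ (_ : E)).symm)
    exact (mfderiv_mul_left_mulInvariantVectorField w a (γ t)).symm
  exact HasMFDerivWithinAt.congr_mfderiv h₁ h₂.symm

theorem t2Space_of_lieGroup (E : Type*) [NormedAddCommGroup E] [NormedSpace ℝ E]
    (G : Type*) [TopologicalSpace G] [ChartedSpace E G] [Group G] [LieGroup 𝓘(ℝ, E) ∞ G] :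
    T2Space G := by
  have : IsTopologicalGroup G := topologicalGroup_of_lieGroup 𝓘(ℝ, E) ∞
  have : T1Space G := ChartedSpace.t1Space E G
  infer_instance

/-- An integral curve of a left-invariant vector field is smooth near time `0`. -/
theorem contMDiffAt_zero_of_isMIntegralCurve {γ : ℝ → G} {w : GroupLieAlgebra 𝓘(ℝ, E) G}
    (hγ : IsMIntegralCurve γ (mulInvariantVectorField (I := 𝓘(ℝ, E)) w)) (h0 : γ 0 = 1) :
    ContMDiffAt 𝓘(ℝ, ℝ) 𝓘(ℝ, E) ∞ γ 0 := by
  set φ := extChartAt 𝓘(ℝ, E) (1 : G) with hφ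
  have : IsManifold 𝓘(ℝ, E) 1 G := .of_le (n := ∞) (by simp)
  have hsrc : ∀ᶠ t in 𝓝 (0 : ℝ), γ t ∈ φ.source := by
    refine (hγ 0).continuousAt.eventually (p := fun g ↦ g ∈ φ.source) ?_
    rw [h0]
    exact extChartAt_source_mem_nhds _
  have hV : ContDiffAt ℝ ∞ (fun a ↦ fderiv ℝ (chartMul E G) (a, φ 1) ((0 : E), (w : E)))
      ((φ ∘ γ) 0) := by
    rw [Function.comp_apply, h0]
    exact (((contDiffAt_chartMul (G := G) (mem_extChartAt_target _)).fderiv_right (m := ∞)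
      (by simp)).comp
      (f := fun a : E ↦ (a, φ 1)) (φ 1) (contDiffAt_id.prodMk contDiffAt_const)).clm_apply
        contDiffAt_const
  have hc : ContDiffAt ℝ ∞ (φ ∘ γ) 0 := by
    refine contDiffAt_of_hasDerivAt_comp hV ?_
    filter_upwards [hsrc] with t ht
    have h₁ : MDifferentiableAt 𝓘(ℝ, E) 𝓘(ℝ, E) φ (γ t) :=
      mdifferentiableAt_extChartAt (by rwa [hφ, extChartAt_source] at ht)
    have h₂ := (h₁.hasMFDerivAt.comp t (hγ t)).hasFDerivAt
    have h₃ : HasDerivAt (φ ∘ γ) _ t := HasFDerivAt.hasDerivAt h₂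
    refine h₃.congr_deriv ?_
    refine Eq.trans ?_ (mfderiv_extChartAt_mulInvariantVectorField ht w)
    exact congrArg (mfderiv 𝓘(ℝ, E) 𝓘(ℝ, E) φ (γ t) : E →L[ℝ] E) (one_smul ℝ (_ : E))
  have h₁ : ContMDiffAt 𝓘(ℝ, ℝ) 𝓘(ℝ, E) ∞ (φ.symm ∘ (φ ∘ γ)) 0 := by
    refine ContMDiffAt.comp (I' := 𝓘(ℝ, E)) 0 ?_ hc.contMDiffAt
    rw [Function.comp_apply, h0]
    exact (contMDiffOn_extChartAt_symm (1 : G)).contMDiffAt (extChartAt_target_mem_nhds _)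
  refine h₁.congr_of_eventuallyEq ?_
  filter_upwards [hsrc] with t ht
  exact (φ.left_inv ht).symm

/-- Every element of the Lie algebra of a Lie group generates a one-parameter subgroup: the
integral curve through `1` of the corresponding left-invariant vector field, which exists for all
times because left translates of a local integral curve are integral curves. -/
theorem exists_isOneParameterSubgroup [CompleteSpace E] (x : GroupLieAlgebra 𝓘(ℝ, E) G) :
    ∃ γ : ℝ → G, IsOneParameterSubgroup γ x := by
  have : IsManifold 𝓘(ℝ, E) 1 G := .of_le (n := ∞) (by simp)
  have := t2Space_of_lieGroup E G
  have hv : ContMDiff 𝓘(ℝ, E) 𝓘(ℝ, E).tangent 1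
      (fun g ↦ (⟨g, mulInvariantVectorField x g⟩ : TangentBundle 𝓘(ℝ, E) G)) :=
    (contMDiff_mulInvariantVectorField x).of_le (by
      rw [minSmoothness_of_isRCLikeNormedField]; exact one_le_two)
  obtain ⟨γ₀, h₀, hγ₀⟩ := exists_isMIntegralCurveAt_of_contMDiffAt_boundaryless 0
    (hv.contMDiffAt (x := (1 : G)))
  obtain ⟨ε, hε, hγ₀⟩ := isMIntegralCurveAt_iff'.1 hγ₀
  rw [Real.ball_eq_Ioo, zero_sub, zero_add] at hγ₀
  obtain ⟨γ, h0, hγ⟩ := exists_isMIntegralCurve_of_isMIntegralCurveOn hv hε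
    (fun a ↦ ⟨fun t ↦ a * γ₀ t, by simp [h₀], isMIntegralCurveOn_mul_left hγ₀ a⟩) 1
  have hadd (s t : ℝ) : γ (s + t) = γ s * γ t := by
    have h₁ : IsMIntegralCurve (fun t ↦ γ s * γ t) (mulInvariantVectorField x) := by
      rw [isMIntegralCurve_iff_isMIntegralCurveOn] at hγ ⊢
      exact isMIntegralCurveOn_mul_left hγ (γ s)
    have h₂ := isMIntegralCurve_Ioo_eq_of_contMDiff_boundaryless (t₀ := 0) hv (hγ.comp_add s) h₁
      (by simp [h0])
    rw [add_comm]
    exact congrFun h₂ t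
  refine ⟨γ, ⟨fun t ↦ ?_, hadd, ?_⟩⟩
  · have h₁ : γ = (fun g ↦ γ t * g) ∘ γ ∘ fun s ↦ s - t := by
      ext s
      simp [← hadd]
    rw [h₁]
    refine ContMDiffAt.comp (I' := 𝓘(ℝ, E)) t contMDiff_mul_left.contMDiffAt
      (ContMDiffAt.comp (I' := 𝓘(ℝ, ℝ)) t ?_ (contDiff_id.sub contDiff_const).contMDiff.contMDiffAt)
    rw [sub_self]
    exact contMDiffAt_zero_of_isMIntegralCurve hγ h0
  · have h₁ : velocity E γ = (mulInvariantVectorField x (γ 0) : E) :=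
      (DFunLike.congr_fun (hγ 0).mfderiv (1 : ℝ)).trans (one_smul ℝ (_ : E))
    rw [h₁, h0, mulInvariantVectorField]
    have h₂ : (fun g : G ↦ 1 * g) = id := by ext; simp
    rw [h₂, mfderiv_id]
    rfl

end OneParameterSubgroups

/-! ### Linear differential equations and invariant subspaces -/

section LinearODE

variable {V : Type*} [NormedAddCommGroup V] [NormedSpace ℝ V] [FiniteDimensional ℝ V]

/-- A subspace which is invariant under `B` contains the solutions of `c' = B c` that start in
it. -/
theorem mem_of_hasDerivAt_of_invariant {B : V →ₗ[ℝ] V} {k : Submodule ℝ V}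
    (hB : ∀ y ∈ k, B y ∈ k) {c : ℝ → V} (hc : ∀ t, HasDerivAt c (B (c t)) t) (h0 : c 0 ∈ k)
    (t : ℝ) : c t ∈ k := by
  have : CompleteSpace V := FiniteDimensional.complete ℝ V
  let B' : V →L[ℝ] V := B.toContinuousLinearMap
  -- The solution is `c t = exp (t B) (c 0)`, because `s ↦ exp ((t - s) B) (c s)` is constant.
  have hF (s : ℝ) : HasDerivAt (fun s ↦ NormedSpace.exp ((t - s) • B') (c s)) 0 s := by
    have h₁ := (hasDerivAt_exp_smul_const B' (t - s)).scomp s ((hasDerivAt_id s).const_sub t)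
    have h₂ := h₁.clm_apply (hc s)
    refine h₂.congr_deriv ?_
    simp [B']
  have hconst := is_const_of_deriv_eq_zero (fun s ↦ (hF s).differentiableAt)
    (fun s ↦ (hF s).deriv) t 0
  simp only [sub_self, zero_smul, NormedSpace.exp_zero, sub_zero] at hconst
  refine Set.mem_of_eq_of_mem (s := (k : Set V)) hconst ?_
  have hpow (n : ℕ) : ((t • B') ^ n) (c 0) ∈ k := by
    induction n with
    | zero => simpa using h0
    | succ n ih =>
      rw [pow_succ']
      exact k.smul_mem t (hB _ ih)
  have hs := (ContinuousLinearMap.apply ℝ V (c 0)).hasSum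
    (NormedSpace.exp_series_hasSum_exp' (𝕂 := ℝ) (t • B'))
  refine k.closed_of_finiteDimensional.mem_of_tendsto hs (Filter.Eventually.of_forall fun s ↦ ?_)
  exact sum_mem fun n _ ↦ k.smul_mem _ (hpow n)

theorem mem_of_hasDerivAt {k : Submodule ℝ V} {c : ℝ → V} {v : V} {t₀ : ℝ}
    (hc : HasDerivAt c v t₀) (hk : ∀ t, c t ∈ k) : v ∈ k := by
  refine k.closed_of_finiteDimensional.mem_of_tendsto (hasDerivAt_iff_tendsto_slope.1 hc)
    (Filter.Eventually.of_forall fun s ↦ ?_)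
  exact k.smul_mem _ (k.sub_mem (hk s) (hk t₀))

theorem hasDerivAt_bilin (Q : LinearMap.BilinForm ℝ V) {c d : ℝ → V} {c' d' : V} {t : ℝ}
    (hc : HasDerivAt c c' t) (hd : HasDerivAt d d' t) :
    HasDerivAt (fun t ↦ Q (c t) (d t)) (Q c' (d t) + Q (c t) d') t :=
  (Q.toContinuousBilinearMap.hasFDerivAt.comp_hasDerivAt t hc).clm_apply hd

end LinearODE

/-! ### The adjoint representation along one-parameter subgroups -/

section Adjoint

open Filter Topology

variable {E : Type*} [NormedAddCommGroup E] [NormedSpace ℝ E]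
  {G : Type*} [TopologicalSpace G] [ChartedSpace E G] [Group G]

theorem IsOneParameterSubgroup.map_zero {γ : ℝ → G} {x : GroupLieAlgebra 𝓘(ℝ, E) G}
    (hγ : IsOneParameterSubgroup γ x) : γ 0 = 1 := by
  have := hγ.map_add 0 0
  rwa [add_zero, left_eq_mul] at this

theorem IsOneParameterSubgroup.mul_neg {γ : ℝ → G} {x : GroupLieAlgebra 𝓘(ℝ, E) G}
    (hγ : IsOneParameterSubgroup γ x) (t : ℝ) : γ t * γ (-t) = 1 := by
  rw [← hγ.map_add, add_neg_cancel, hγ.map_zero]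

theorem IsOneParameterSubgroup.map_neg {γ : ℝ → G} {x : GroupLieAlgebra 𝓘(ℝ, E) G}
    (hγ : IsOneParameterSubgroup γ x) (t : ℝ) : γ (-t) = (γ t)⁻¹ :=
  (inv_eq_of_mul_eq_one_right (hγ.mul_neg t)).symm

theorem IsOneParameterSubgroup.comp_mul {γ : ℝ → G} {x : GroupLieAlgebra 𝓘(ℝ, E) G}
    (hγ : IsOneParameterSubgroup γ x) (c : ℝ) :
    IsOneParameterSubgroup (fun t ↦ γ (c * t)) (c • x) where
  smooth := hγ.smooth.comp (contDiff_const.mul contDiff_id).contMDiff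
  map_add s t := by rw [mul_add, hγ.map_add]
  velocity_eq := by rw [velocity_comp_mul hγ.smooth, hγ.velocity_eq]

theorem IsOneParameterSubgroup.mem_analyticSubgroup {γ : ℝ → G}
    {x : GroupLieAlgebra 𝓘(ℝ, E) G} (hγ : IsOneParameterSubgroup γ x)
    {k : Submodule ℝ (GroupLieAlgebra 𝓘(ℝ, E) G)} (hx : x ∈ k) (t : ℝ) :
    γ t ∈ analyticSubgroup k :=
  Subgroup.subset_closure ⟨t • x, k.smul_mem t hx, _, hγ.comp_mul t, by simp⟩

theorem analyticSubgroup_induction {k : Submodule ℝ (GroupLieAlgebra 𝓘(ℝ, E) G)}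
    {p : (a : G) → a ∈ analyticSubgroup k → Prop}
    (exp : ∀ x (hx : x ∈ k) (γ : ℝ → G) (hγ : IsOneParameterSubgroup γ x) (t : ℝ),
      p (γ t) (hγ.mem_analyticSubgroup hx t))
    (one : p 1 (one_mem _))
    (mul : ∀ a b ha hb, p a ha → p b hb → p (a * b) (mul_mem ha hb)) {a : G}
    (ha : a ∈ analyticSubgroup k) : p a ha := by
  induction ha using Subgroup.closure_induction'' with
  | mem a ha =>
    obtain ⟨x, hx, γ, hγ, rfl⟩ := ha
    exact exp x hx γ hγ 1
  | inv_mem a ha =>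
    obtain ⟨x, hx, γ, hγ, rfl⟩ := ha
    simp only [← hγ.map_neg]
    exact exp x hx γ hγ (-1)
  | one => exact one
  | mul a b ha hb iha ihb => exact mul a b ha hb iha ihb

/-- The chain rule for a curve through `1`. -/
theorem mfderiv_comp_curve {F : Type*} [NormedAddCommGroup F] [NormedSpace ℝ F]
    {N : Type*} [TopologicalSpace N] [ChartedSpace F N] {f : G → N} {γ : ℝ → G}
    (hf : MDifferentiableAt 𝓘(ℝ, E) 𝓘(ℝ, F) f 1)
    (hγ : MDifferentiableAt 𝓘(ℝ, ℝ) 𝓘(ℝ, E) γ 0) (h0 : γ 0 = 1) :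
    (mfderiv 𝓘(ℝ, ℝ) 𝓘(ℝ, F) (fun t ↦ f (γ t)) 0 : ℝ →L[ℝ] F) 1 =
      (mfderiv 𝓘(ℝ, E) 𝓘(ℝ, F) f 1 : E →L[ℝ] F) (velocity E γ) := by
  have h₁ : MDifferentiableAt 𝓘(ℝ, E) 𝓘(ℝ, F) f (γ 0) := by rwa [h0]
  have h₂ := mfderiv_comp 0 h₁ hγ
  rw [h0] at h₂
  exact DFunLike.congr_fun h₂ (1 : ℝ)

theorem Ad_one (x : GroupLieAlgebra 𝓘(ℝ, E) G) : Ad (1 : G) x = x := by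
  have h₁ : (fun b : G ↦ 1 * b * 1⁻¹) = id := by ext; simp
  rw [Ad, h₁, mfderiv_id]
  rfl

variable [LieGroup 𝓘(ℝ, E) ∞ G]

theorem Ad_mul (a b : G) (x : GroupLieAlgebra 𝓘(ℝ, E) G) : Ad (a * b) x = Ad a (Ad b x) := by
  have h₁ : MDifferentiableAt 𝓘(ℝ, E) 𝓘(ℝ, E) (fun g : G ↦ a * g * a⁻¹) (b * 1 * b⁻¹) :=
    mdifferentiableAt_conj a _
  have h₂ := mfderiv_comp (1 : G) h₁ (mdifferentiableAt_conj b 1)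
  have h₃ : (fun g : G ↦ a * g * a⁻¹) ∘ (fun g : G ↦ b * g * b⁻¹) =
      fun g ↦ a * b * g * (a * b)⁻¹ := by
    ext g; simp [mul_assoc]
  rw [h₃, mul_one, mul_inv_cancel] at h₂
  exact DFunLike.congr_fun h₂ x

theorem Ad_Ad_inv (a : G) (x : GroupLieAlgebra 𝓘(ℝ, E) G) : Ad a (Ad a⁻¹ x) = x := by
  rw [← Ad_mul, mul_inv_cancel, Ad_one]

theorem velocity_conj {γ : ℝ → G} (hγ : ContMDiff 𝓘(ℝ, ℝ) 𝓘(ℝ, E) ∞ γ) (h0 : γ 0 = 1) (a : G) :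
    velocity E (fun t ↦ a * γ t * a⁻¹) = Ad a (velocity E γ) :=
  mfderiv_comp_curve (mdifferentiableAt_conj a 1) (hγ.mdifferentiableAt (by simp)) h0

/-- `a exp(x) a⁻¹ = exp (Ad a x)`. -/
theorem IsOneParameterSubgroup.conj {γ : ℝ → G} {x : GroupLieAlgebra 𝓘(ℝ, E) G}
    (hγ : IsOneParameterSubgroup γ x) (a : G) :
    IsOneParameterSubgroup (fun t ↦ a * γ t * a⁻¹) (Ad a x) where
  smooth := (contMDiff_const.mul hγ.smooth).mul contMDiff_const
  map_add s t := by rw [hγ.map_add]; group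
  velocity_eq := by rw [velocity_conj hγ.smooth hγ.map_zero, hγ.velocity_eq]

theorem IsOneParameterSubgroup.hasDerivAt_Ad_zero {γ : ℝ → G} {x : GroupLieAlgebra 𝓘(ℝ, E) G}
    (hγ : IsOneParameterSubgroup γ x) (w : GroupLieAlgebra 𝓘(ℝ, E) G) :
    HasDerivAt (F := E) (fun t ↦ Ad (γ t) w)
      (⁅x, w⁆ : GroupLieAlgebra 𝓘(ℝ, E) G) 0 := by
  have := hasDerivAt_Ad_apply (hγ.smooth.mdifferentiableAt (by simp)) hγ.map_zero w
  rwa [hγ.velocity_eq] at this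

theorem IsOneParameterSubgroup.hasDerivAt_Ad {γ : ℝ → G} {x : GroupLieAlgebra 𝓘(ℝ, E) G}
    (hγ : IsOneParameterSubgroup γ x) (w : GroupLieAlgebra 𝓘(ℝ, E) G) (t : ℝ) :
    HasDerivAt (F := E) (fun t ↦ Ad (γ t) w)
      (⁅x, Ad (γ t) w⁆ : GroupLieAlgebra 𝓘(ℝ, E) G) t := by
  have h₁ : HasDerivAt (F := E) (fun s ↦ Ad (γ s) (Ad (γ t) w))
      (⁅x, Ad (γ t) w⁆ : GroupLieAlgebra 𝓘(ℝ, E) G) (t - t) := by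
    rw [sub_self]
    exact hγ.hasDerivAt_Ad_zero _
  have h₂ := HasDerivAt.comp_sub_const (𝕜 := ℝ) (F := E) t t h₁
  refine HasDerivAt.congr_of_eventuallyEq (F := E) h₂ (Eventually.of_forall fun s ↦ ?_)
  change Ad (γ s) w = Ad (γ (s - t)) (Ad (γ t) w)
  rw [← Ad_mul, ← hγ.map_add, sub_add_cancel]

variable [FiniteDimensional ℝ E] [CompleteSpace E]

theorem IsOneParameterSubgroup.Ad_mem {γ : ℝ → G} {x : GroupLieAlgebra 𝓘(ℝ, E) G}
    (hγ : IsOneParameterSubgroup γ x) {k : Submodule ℝ (GroupLieAlgebra 𝓘(ℝ, E) G)}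
    (hk : ∀ y ∈ k, ⁅x, y⁆ ∈ k) {y : GroupLieAlgebra 𝓘(ℝ, E) G} (hy : y ∈ k) (t : ℝ) :
    Ad (γ t) y ∈ k :=
  mem_of_hasDerivAt_of_invariant (V := E)
    (B := LieAlgebra.ad ℝ (GroupLieAlgebra 𝓘(ℝ, E) G) x) (k := k) hk (hγ.hasDerivAt_Ad y)
    (show Ad (γ 0) y ∈ k by rw [hγ.map_zero, Ad_one]; exact hy) t

omit [CompleteSpace E] in
theorem IsOneParameterSubgroup.lie_mem {γ : ℝ → G} {x : GroupLieAlgebra 𝓘(ℝ, E) G}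
    (hγ : IsOneParameterSubgroup γ x) {k : Submodule ℝ (GroupLieAlgebra 𝓘(ℝ, E) G)}
    {y : GroupLieAlgebra 𝓘(ℝ, E) G} (hk : ∀ t, Ad (γ t) y ∈ k) : ⁅x, y⁆ ∈ k :=
  mem_of_hasDerivAt (V := E) (k := k) (hγ.hasDerivAt_Ad_zero y) hk

/-- A subspace normalized by `k'` is stable under the adjoint action of the analytic subgroup
of `k'`. -/
theorem Ad_mem_of_mem_analyticSubgroup {k' k : Submodule ℝ (GroupLieAlgebra 𝓘(ℝ, E) G)}
    (hk : ∀ x ∈ k', ∀ y ∈ k, ⁅x, y⁆ ∈ k) {a : G} (ha : a ∈ analyticSubgroup k')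
    {y : GroupLieAlgebra 𝓘(ℝ, E) G} (hy : y ∈ k) : Ad a y ∈ k := by
  induction ha using analyticSubgroup_induction generalizing y with
  | exp x hx γ hγ t => exact hγ.Ad_mem (hk x hx) hy t
  | one => rwa [Ad_one]
  | mul a b _ _ ha hb => rw [Ad_mul]; exact ha (hb hy)

/-- If `ad x` is skew for a bilinear form on an `ad x`-stable subspace `k`, then
`Ad (exp (t x))` preserves the form on `k`. -/
theorem IsOneParameterSubgroup.form_Ad {γ : ℝ → G} {x : GroupLieAlgebra 𝓘(ℝ, E) G}
    (hγ : IsOneParameterSubgroup γ x) {k : Submodule ℝ (GroupLieAlgebra 𝓘(ℝ, E) G)}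
    (hk : ∀ y ∈ k, ⁅x, y⁆ ∈ k) {Q : LinearMap.BilinForm ℝ (GroupLieAlgebra 𝓘(ℝ, E) G)}
    (hQ : ∀ u ∈ k, ∀ v ∈ k, Q ⁅x, u⁆ v + Q u ⁅x, v⁆ = 0) {u v : GroupLieAlgebra 𝓘(ℝ, E) G}
    (hu : u ∈ k) (hv : v ∈ k) (t : ℝ) : Q (Ad (γ t) u) (Ad (γ t) v) = Q u v := by
  have hd (t : ℝ) : HasDerivAt (fun t ↦ Q (Ad (γ t) u) (Ad (γ t) v)) 0 t :=
    (hasDerivAt_bilin (V := E) Q (hγ.hasDerivAt_Ad u t) (hγ.hasDerivAt_Ad v t)).congr_deriv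
      (hQ _ (hγ.Ad_mem hk hu t) _ (hγ.Ad_mem hk hv t))
  have := is_const_of_deriv_eq_zero (fun s ↦ (hd s).differentiableAt) (fun s ↦ (hd s).deriv) t 0
  rwa [hγ.map_zero, Ad_one, Ad_one] at this

theorem form_Ad_of_mem_analyticSubgroup {k' k : Submodule ℝ (GroupLieAlgebra 𝓘(ℝ, E) G)}
    (hk : ∀ x ∈ k', ∀ y ∈ k, ⁅x, y⁆ ∈ k)
    {Q : LinearMap.BilinForm ℝ (GroupLieAlgebra 𝓘(ℝ, E) G)}
    (hQ : ∀ x ∈ k', ∀ u ∈ k, ∀ v ∈ k, Q ⁅x, u⁆ v + Q u ⁅x, v⁆ = 0) {a : G}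
    (ha : a ∈ analyticSubgroup k') {u v : GroupLieAlgebra 𝓘(ℝ, E) G}
    (hu : u ∈ k) (hv : v ∈ k) : Q (Ad a u) (Ad a v) = Q u v := by
  have : ∀ u ∈ k, ∀ v ∈ k, Ad a u ∈ k ∧ Q (Ad a u) (Ad a v) = Q u v := by
    clear! u v
    induction ha using analyticSubgroup_induction with
    | exp x hx γ hγ t =>
      exact fun u hu v hv ↦ ⟨hγ.Ad_mem (hk x hx) hu t, hγ.form_Ad (hk x hx) (hQ x hx) hu hv t⟩
    | one => exact fun u hu v hv ↦ ⟨by rwa [Ad_one], by rw [Ad_one, Ad_one]⟩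
    | mul a b _ _ ha hb =>
      intro u hu v hv
      rw [Ad_mul, Ad_mul, (ha _ (hb u hu v hv).1 _ (hb v hv v hv).1).2]
      exact ⟨(ha _ (hb u hu v hv).1 _ (hb v hv v hv).1).1, (hb u hu v hv).2⟩
  exact (this u hu v hv).2

omit [CompleteSpace E] in
/-- A bilinear form preserved by `Ad (exp (t x))` is skew for `ad x`. -/
theorem IsOneParameterSubgroup.form_skew {γ : ℝ → G} {x : GroupLieAlgebra 𝓘(ℝ, E) G}
    (hγ : IsOneParameterSubgroup γ x) {Q : LinearMap.BilinForm ℝ (GroupLieAlgebra 𝓘(ℝ, E) G)}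
    {u v : GroupLieAlgebra 𝓘(ℝ, E) G} (hQ : ∀ t, Q (Ad (γ t) u) (Ad (γ t) v) = Q u v) :
    Q ⁅x, u⁆ v + Q u ⁅x, v⁆ = 0 := by
  have h₁ := hasDerivAt_bilin (V := E) Q (hγ.hasDerivAt_Ad_zero u) (hγ.hasDerivAt_Ad_zero v)
  simp only [hγ.map_zero, Ad_one] at h₁
  have h₂ : (fun t ↦ Q (Ad (γ t) u) (Ad (γ t) v)) = fun _ ↦ Q u v := funext hQ
  have h₃ : HasDerivAt (fun _ : ℝ ↦ Q u v) (Q ⁅x, u⁆ v + Q u ⁅x, v⁆) 0 := h₂ ▸ h₁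
  exact h₃.unique (hasDerivAt_const _ _)

end Adjoint

/-! ### Orbit maps and the isotropy algebra -/

section Orbits

open Filter Topology

variable {E : Type*} [NormedAddCommGroup E] [NormedSpace ℝ E]
  {E' : Type*} [NormedAddCommGroup E'] [NormedSpace ℝ E']
  {G : Type*} [TopologicalSpace G] [ChartedSpace E G] [Group G]
  {M : Type*} [TopologicalSpace M] [ChartedSpace E' M] [MulAction G M]
  [hact : ContMDiffSMul 𝓘(ℝ, E) 𝓘(ℝ, E') ∞ G M]

include hact in
theorem contMDiff_orbit (p : M) : ContMDiff 𝓘(ℝ, E) 𝓘(ℝ, E') ∞ (fun a : G ↦ a • p) :=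
  (hact.contMDiff_smul).comp (contMDiff_id.prodMk contMDiff_const)

include hact in
theorem contMDiff_smul_point (a : G) : ContMDiff 𝓘(ℝ, E') 𝓘(ℝ, E') ∞ (fun p : M ↦ a • p) :=
  (hact.contMDiff_smul).comp (contMDiff_const.prodMk contMDiff_id)

include hact in
theorem mfderiv_orbit_curve (o : M) {γ : ℝ → G} (hγ : MDifferentiableAt 𝓘(ℝ, ℝ) 𝓘(ℝ, E) γ 0)
    (h0 : γ 0 = 1) :
    (mfderiv 𝓘(ℝ, ℝ) 𝓘(ℝ, E') (fun t ↦ γ t • o) 0 : ℝ →L[ℝ] E') 1 =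
      orbitDeriv (E' := E') E G o (velocity E γ) :=
  mfderiv_comp_curve ((contMDiff_orbit o).mdifferentiableAt (by simp)) hγ h0

include hact in
/-- The chain rule for the action of a product. -/
theorem mfderiv_smul_smul (a b : G) (p : M) (v : E') :
    (mfderiv 𝓘(ℝ, E') 𝓘(ℝ, E') (fun q : M ↦ (a * b) • q) p : E' →L[ℝ] E') v =
      (mfderiv 𝓘(ℝ, E') 𝓘(ℝ, E') (fun q : M ↦ a • q) (b • p) : E' →L[ℝ] E')
        ((mfderiv 𝓘(ℝ, E') 𝓘(ℝ, E') (fun q : M ↦ b • q) p : E' →L[ℝ] E') v) := by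
  have h₁ : (fun q : M ↦ (a * b) • q) = (fun q : M ↦ a • q) ∘ fun q ↦ b • q := by
    ext q; simp [mul_smul]
  rw [h₁]
  exact DFunLike.congr_fun (mfderiv_comp p
    ((contMDiff_smul_point (E := E) a).mdifferentiableAt (by simp))
    ((contMDiff_smul_point (E := E) b).mdifferentiableAt (by simp))) v

omit [TopologicalSpace G] hact in
theorem mfderiv_one_smul (p : M) (v : E') :
    (mfderiv 𝓘(ℝ, E') 𝓘(ℝ, E') (fun q : M ↦ (1 : G) • q) p : E' →L[ℝ] E') v = v := by
  have h₁ : (fun q : M ↦ (1 : G) • q) = id := by ext q; simp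
  rw [h₁, mfderiv_id]
  rfl

variable [LieGroup 𝓘(ℝ, E) ∞ G]

/-- The identification `g → T_o M` intertwines `Ad a` with the differential of `a`, for `a` in the
isotropy group. -/
theorem orbitDeriv_Ad {o : M} {a : G} (ha : a ∈ MulAction.stabilizer G o)
    (x : GroupLieAlgebra 𝓘(ℝ, E) G) :
    (orbitDeriv (E' := E') E G o (Ad a x) : E') =
      (mfderiv 𝓘(ℝ, E') 𝓘(ℝ, E') (fun q : M ↦ a • q) o : E' →L[ℝ] E')
        (orbitDeriv (E' := E') E G o x) := by
  have h₁ : MDifferentiableAt 𝓘(ℝ, E) 𝓘(ℝ, E') (fun b : G ↦ b • o) (a * 1 * a⁻¹) :=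
    (contMDiff_orbit o).mdifferentiableAt (by simp)
  have h₂ := mfderiv_comp (1 : G) h₁ (mdifferentiableAt_conj a 1)
  have h₃ : MDifferentiableAt 𝓘(ℝ, E') 𝓘(ℝ, E') (fun q : M ↦ a • q) ((1 : G) • o) :=
    (contMDiff_smul_point (E := E) a).mdifferentiableAt (by simp)
  have h₄ := mfderiv_comp (1 : G) h₃
    ((contMDiff_orbit (E := E) (E' := E') o).mdifferentiableAt (by simp))
  have h₅ : (fun b : G ↦ b • o) ∘ (fun b : G ↦ a * b * a⁻¹) =
      (fun q : M ↦ a • q) ∘ (fun b : G ↦ b • o) := by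
    ext b
    simp only [Function.comp_apply, mul_smul]
    rw [MulAction.mem_stabilizer_iff.1 (inv_mem ha)]
  rw [h₅, mul_one, mul_inv_cancel] at h₂
  rw [one_smul] at h₄
  exact (DFunLike.congr_fun h₂ x).symm.trans (DFunLike.congr_fun h₄ x)

theorem isotropyAlgebra_le_ker {o : M} {x : GroupLieAlgebra 𝓘(ℝ, E) G}
    (hx : x ∈ isotropyAlgebra E G o) : (orbitDeriv (E' := E') E G o x : E') = 0 := by
  obtain ⟨γ, hγ, h0, hH, rfl⟩ := hx
  have h₁ : (orbitDeriv (E' := E') E G o (velocity E γ) : E') = _ :=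
    (mfderiv_orbit_curve o (hγ.mdifferentiableAt (by simp)) h0).symm
  have h₂ : (fun t ↦ γ t • o) = fun _ ↦ o := funext hH
  rw [h₁, h₂, mfderiv_const]
  rfl

variable [IsManifold 𝓘(ℝ, E') ∞ M] [T2Space M]

omit [LieGroup 𝓘(ℝ, E) ∞ G] in
/-- A one-parameter subgroup whose velocity is mapped to `0` in `T_o M` fixes `o`, since its orbit
through `o` is an integral curve of the zero vector field. -/
theorem IsOneParameterSubgroup.smul_eq [CompleteSpace E'] {o : M} {γ : ℝ → G}
    {x : GroupLieAlgebra 𝓘(ℝ, E) G}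
    (hγ : IsOneParameterSubgroup γ x) (hx : (orbitDeriv (E' := E') E G o x : E') = 0) (t : ℝ) :
    γ t • o = o := by
  have : IsManifold 𝓘(ℝ, E') 1 M := .of_le (n := ∞) (by simp)
  have hc : ContMDiff 𝓘(ℝ, ℝ) 𝓘(ℝ, E') ∞ (fun t ↦ γ t • o) :=
    (contMDiff_orbit o).comp hγ.smooth
  have h0 : (mfderiv 𝓘(ℝ, ℝ) 𝓘(ℝ, E') (fun t ↦ γ t • o) 0 : ℝ →L[ℝ] E') = 0 := by
    refine ContinuousLinearMap.ext_ring ?_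
    refine (mfderiv_orbit_curve o (hγ.smooth.mdifferentiableAt (by simp)) hγ.map_zero).trans ?_
    rw [hγ.velocity_eq]
    exact hx
  -- The orbit at time `s` is the image under `γ s` of the orbit at time `0`.
  have hz (s : ℝ) : HasMFDerivAt 𝓘(ℝ, ℝ) 𝓘(ℝ, E') (fun t ↦ γ t • o) s
      (0 : ℝ →L[ℝ] E') := by
    have h₁ : HasMFDerivAt 𝓘(ℝ, ℝ) 𝓘(ℝ, ℝ) (fun t : ℝ ↦ t - s) s
        (ContinuousLinearMap.id ℝ ℝ) := ((hasFDerivAt_id s).sub_const s).hasMFDerivAt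
    have h₂ : HasMFDerivAt 𝓘(ℝ, ℝ) 𝓘(ℝ, E') (fun t ↦ γ t • o) (s - s) (0 : ℝ →L[ℝ] E') := by
      have h₃ := (hc.mdifferentiableAt (by simp) (x := (0 : ℝ))).hasMFDerivAt
      rw [sub_self]
      exact HasMFDerivAt.congr_mfderiv h₃ h0
    have h₃ := ((contMDiff_smul_point (E := E) (E' := E') (γ s)).mdifferentiableAt (by simp)
      (x := γ (s - s) • o)).hasMFDerivAt.comp s (HasMFDerivAt.comp (f := fun t : ℝ ↦ t - s) s h₂ h₁)
    have h₄ : (fun q : M ↦ γ s • q) ∘ (fun t ↦ γ t • o) ∘ (fun t ↦ t - s) = fun t ↦ γ t • o := by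
      ext t
      simp only [Function.comp_apply]
      rw [← mul_smul, ← hγ.map_add, add_sub_cancel]
    rw [h₄] at h₃
    refine HasMFDerivAt.congr_mfderiv h₃ ?_
    refine ContinuousLinearMap.ext_ring ?_
    exact ContinuousLinearMap.map_zero (mfderiv 𝓘(ℝ, E') 𝓘(ℝ, E') (fun q : M ↦ γ s • q)
      (γ (s - s) • o) : E' →L[ℝ] E')
  have hv : ContMDiff 𝓘(ℝ, E') 𝓘(ℝ, E').tangent 1
      (fun q : M ↦ (⟨q, 0⟩ : TangentBundle 𝓘(ℝ, E') M)) := Bundle.contMDiff_zeroSection ℝ _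
  have h₁ : IsMIntegralCurve (fun t ↦ γ t • o) (fun q : M ↦ (0 : TangentSpace 𝓘(ℝ, E') q)) := by
    intro s
    refine HasMFDerivAt.congr_mfderiv (hz s) ?_
    exact ContinuousLinearMap.ext_ring (smul_zero (1 : ℝ)).symm
  have h₂ : IsMIntegralCurve (fun _ : ℝ ↦ o) (fun q : M ↦ (0 : TangentSpace 𝓘(ℝ, E') q)) := by
    intro s
    refine HasMFDerivAt.congr_mfderiv (hasMFDerivAt_const o s) ?_
    exact ContinuousLinearMap.ext_ring (smul_zero (1 : ℝ)).symm
  have h₃ := isMIntegralCurve_Ioo_eq_of_contMDiff_boundaryless (t₀ := 0) hv h₁ h₂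
    (by simp [hγ.map_zero])
  exact congrFun h₃ t

/-- The Lie algebra of the isotropy group is the kernel of `g → T_o M`. -/
theorem mem_isotropyAlgebra_iff [CompleteSpace E] [CompleteSpace E'] {o : M}
    {x : GroupLieAlgebra 𝓘(ℝ, E) G} :
    x ∈ isotropyAlgebra E G o ↔ (orbitDeriv (E' := E') E G o x : E') = 0 := by
  refine ⟨isotropyAlgebra_le_ker, fun hx ↦ ?_⟩
  obtain ⟨γ, hγ⟩ := exists_isOneParameterSubgroup x
  exact ⟨γ, hγ.smooth, hγ.map_zero, fun t ↦ hγ.smul_eq hx t, hγ.velocity_eq⟩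

end Orbits

/-! ### Local sections of orbit maps and transitivity -/

section Sections

open Filter Topology

variable {E : Type*} [NormedAddCommGroup E] [NormedSpace ℝ E] [CompleteSpace E]
  {E' : Type*} [NormedAddCommGroup E'] [NormedSpace ℝ E'] [FiniteDimensional ℝ E']
  {G : Type*} [TopologicalSpace G] [ChartedSpace E G] [Group G] [LieGroup 𝓘(ℝ, E) ∞ G]

/-- Every linear map `L` into a subspace `k` of the Lie algebra is the differential at `0` of a
smooth map into the analytic subgroup of `k`: in coordinates a product of the maps
`v ↦ exp (vᵢ L bᵢ)`. This replaces the smoothness of the exponential map. -/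
theorem exists_smooth_map_of_linearMap {k : Submodule ℝ (GroupLieAlgebra 𝓘(ℝ, E) G)}
    (L : E' →ₗ[ℝ] GroupLieAlgebra 𝓘(ℝ, E) G) (hL : ∀ v, L v ∈ k) :
    ∃ Φ : E' → G, ContMDiff 𝓘(ℝ, E') 𝓘(ℝ, E) ∞ Φ ∧ Φ 0 = 1 ∧ (∀ v, Φ v ∈ analyticSubgroup k) ∧
      ∀ v, velocity E (fun t : ℝ ↦ Φ (t • v)) = L v := by
  let b := Module.finBasis ℝ E'
  suffices h : ∀ s : Finset (Fin (Module.finrank ℝ E')), ∃ Φ : E' → G,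
      ContMDiff 𝓘(ℝ, E') 𝓘(ℝ, E) ∞ Φ ∧ Φ 0 = 1 ∧ (∀ v, Φ v ∈ analyticSubgroup k) ∧
      ∀ v, velocity E (fun t : ℝ ↦ Φ (t • v)) = ∑ i ∈ s, b.repr v i • L (b i) by
    obtain ⟨Φ, h₁, h₂, h₃, h₄⟩ := h Finset.univ
    refine ⟨Φ, h₁, h₂, h₃, fun v ↦ (h₄ v).trans ?_⟩
    conv_rhs => rw [← b.sum_repr v, map_sum]
    simp only [map_smul]
  intro s
  induction s using Finset.induction_on with
  | empty => exact ⟨fun _ ↦ 1, contMDiff_const, rfl, fun _ ↦ one_mem _, fun v ↦ velocity_const⟩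
  | insert i s hi ih =>
    obtain ⟨Φ, h₁, h₂, h₃, h₄⟩ := ih
    obtain ⟨γ, hγ⟩ := exists_isOneParameterSubgroup (L (b i))
    have hl : ContDiff ℝ ∞ (fun v ↦ b.repr v i) :=
      (LinearMap.toContinuousLinearMap (b.coord i)).contDiff
    refine ⟨fun v ↦ γ (b.repr v i) * Φ v, (hγ.smooth.comp hl.contMDiff).mul h₁,
      by simp [h₂, hγ.map_zero],
      fun v ↦ mul_mem (hγ.mem_analyticSubgroup (hL _) _) (h₃ v), fun v ↦ ?_⟩
    have hline : ContMDiff 𝓘(ℝ, ℝ) 𝓘(ℝ, E') ∞ (fun t : ℝ ↦ t • v) :=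
      (contDiff_id.smul contDiff_const).contMDiff
    have h₅ : (fun t : ℝ ↦ γ (b.repr (t • v) i)) = fun t ↦ γ (b.repr v i * t) := by
      ext t; simp [mul_comm]
    have h₆ := velocity_mul (hγ.smooth.comp (hl.contMDiff.comp hline)) (h₁.comp hline)
      (by simp [hγ.map_zero]) (by simp [h₂])
    refine h₆.trans ?_
    rw [Finset.sum_insert hi, ← h₄ v]
    refine congrArg₂ _ ?_ rfl
    refine (congrArg (velocity E) h₅).trans ?_
    rw [velocity_comp_mul hγ.smooth, hγ.velocity_eq]

variable {M : Type*} [TopologicalSpace M] [ChartedSpace E' M] [MulAction G M]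
  [hact : ContMDiffSMul 𝓘(ℝ, E) 𝓘(ℝ, E') ∞ G M] [IsManifold 𝓘(ℝ, E') ∞ M]

/-- If `k` is mapped onto `T_o M`, then the orbit map of `o` has a smooth local section with values
in the analytic subgroup of `k`. -/
theorem exists_local_section {o : M} {k : Submodule ℝ (GroupLieAlgebra 𝓘(ℝ, E) G)}
    (hk : ∀ v : E', ∃ x ∈ k, (orbitDeriv (E' := E') E G o x : E') = v) :
    ∃ σ : M → G, ContMDiffAt 𝓘(ℝ, E') 𝓘(ℝ, E) ∞ σ o ∧ (∀ p, σ p ∈ analyticSubgroup k) ∧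
      ∀ᶠ p in 𝓝 o, σ p • o = p := by
  have : CompleteSpace E' := FiniteDimensional.complete ℝ E'
  have : IsManifold 𝓘(ℝ, E') 1 M := .of_le (n := ∞) (by simp)
  -- A linear right inverse of `g → T_o M` with values in `k`.
  obtain ⟨L, hL, hLk⟩ : ∃ L : E' →ₗ[ℝ] GroupLieAlgebra 𝓘(ℝ, E) G,
      (∀ v, (orbitDeriv (E' := E') E G o (L v) : E') = v) ∧ ∀ v, L v ∈ k := by
    let f : k →ₗ[ℝ] E' := (orbitDeriv (E' := E') E G o).toLinearMap ∘ₗ k.subtype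
    have hf : LinearMap.range f = ⊤ := by
      refine LinearMap.range_eq_top.2 fun v ↦ ?_
      obtain ⟨x, hx, hv⟩ := hk v
      exact ⟨⟨x, hx⟩, hv⟩
    obtain ⟨g, hg⟩ := f.exists_rightInverse_of_surjective hf
    exact ⟨k.subtype ∘ₗ g, fun v ↦ LinearMap.congr_fun hg v, fun v ↦ (g v).2⟩
  obtain ⟨Φ, hΦ, hΦ0, hΦk, hΦL⟩ := exists_smooth_map_of_linearMap L hLk
  set ψ := extChartAt 𝓘(ℝ, E') o with hψ
  set f : E' → M := fun v ↦ Φ v • o with hf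
  have hfs : ContMDiff 𝓘(ℝ, E') 𝓘(ℝ, E') ∞ f := (contMDiff_orbit (E := E) o).comp hΦ
  have hf0 : f 0 = o := by simp [hf, hΦ0]
  have hfd : (mfderiv 𝓘(ℝ, E') 𝓘(ℝ, E') f 0 : E' →L[ℝ] E') = ContinuousLinearMap.id ℝ E' := by
    refine ContinuousLinearMap.ext fun v : E' ↦ ?_
    have hline : ContMDiff 𝓘(ℝ, ℝ) 𝓘(ℝ, E') ∞ (fun t : ℝ ↦ t • v) :=
      (contDiff_id.smul contDiff_const).contMDiff
    have h₁ := mfderiv_orbit_curve (E' := E') o ((hΦ.comp hline).mdifferentiableAt (by simp))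
      (by simp [hΦ0])
    have h₂ : MDifferentiableAt 𝓘(ℝ, E') 𝓘(ℝ, E') f ((0 : ℝ) • v) :=
      hfs.mdifferentiableAt (by simp)
    have h₃ := mfderiv_comp (0 : ℝ) h₂ (hline.mdifferentiableAt (by simp))
    have h₄ : (mfderiv 𝓘(ℝ, ℝ) 𝓘(ℝ, E') (fun t : ℝ ↦ t • v) 0 : ℝ →L[ℝ] E') 1 = v := by
      have h₅ : HasDerivAt (fun t : ℝ ↦ t • v) v 0 := by
        simpa using (hasDerivAt_id (0 : ℝ)).smul_const v
      rw [mfderiv_eq_fderiv, h₅.hasFDerivAt.fderiv]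
      exact one_smul ℝ v
    rw [zero_smul] at h₃
    have h₆ := DFunLike.congr_fun h₃ (1 : ℝ)
    have h₇ : (mfderiv 𝓘(ℝ, E') 𝓘(ℝ, E') f 0 : E' →L[ℝ] E')
        ((mfderiv 𝓘(ℝ, ℝ) 𝓘(ℝ, E') (fun t : ℝ ↦ t • v) 0 : ℝ →L[ℝ] E') 1) = v := by
      refine Eq.trans h₆.symm (Eq.trans h₁ ?_)
      exact (congrArg (fun y ↦ (orbitDeriv (E' := E') E G o y : E')) (hΦL v)).trans (hL v)
    rw [h₄] at h₇
    exact h₇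
  have hψd : ContMDiffAt 𝓘(ℝ, E') 𝓘(ℝ, E') ∞ ψ (f 0) := by rw [hf0]; exact contMDiffAt_extChartAt
  have hg : ContDiffAt ℝ ∞ (ψ ∘ f) 0 :=
    contMDiffAt_iff_contDiffAt.1 (hψd.comp 0 hfs.contMDiffAt)
  have hg' : HasFDerivAt (ψ ∘ f) (ContinuousLinearEquiv.refl ℝ E' : E' →L[ℝ] E') 0 := by
    have h₁ := mfderiv_eq_fderiv_in_charts (hfs.mdifferentiableAt (by simp) (x := 0)) hf0
    rw [hfd] at h₁
    have h₂ := (hg.differentiableAt (by simp)).hasFDerivAt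
    have h₃ : fderiv ℝ (ψ ∘ f) 0 = ContinuousLinearMap.id ℝ E' := h₁.symm
    rw [h₃] at h₂
    exact h₂
  have hg0 : (ψ ∘ f) 0 = ψ o := by rw [Function.comp_apply, hf0]
  -- The section is `Φ ∘ τ ∘ ψ`, with `τ` the local inverse of `ψ ∘ f`.
  set τ := hg.localInverse hg' (by simp) with hτ
  have hτs : ContDiffAt ℝ ∞ τ (ψ o) := by
    rw [← hg0]; exact hg.to_localInverse hg' (by simp)
  have hτ0 : τ (ψ o) = 0 := by
    rw [← hg0]; exact hg.localInverse_apply_image hg' (by simp)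
  have hτr : ∀ᶠ y in 𝓝 (ψ o), ψ (f (τ y)) = y := by
    rw [← hg0]
    exact (hg.hasStrictFDerivAt' hg' (by simp)).eventually_right_inverse
  have hψo : ContMDiffAt 𝓘(ℝ, E') 𝓘(ℝ, E') ∞ ψ o := contMDiffAt_extChartAt
  have hτψ : ContMDiffAt 𝓘(ℝ, E') 𝓘(ℝ, E') ∞ (fun p ↦ τ (ψ p)) o :=
    ContMDiffAt.comp (I' := 𝓘(ℝ, E')) o hτs.contMDiffAt hψo
  refine ⟨fun p ↦ Φ (τ (ψ p)), hΦ.contMDiffAt.comp o hτψ, fun p ↦ hΦk _, ?_⟩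
  have h₁ : ∀ᶠ p in 𝓝 o, ψ (f (τ (ψ p))) = ψ p := hψo.continuousAt.eventually hτr
  have h₂ : ∀ᶠ p in 𝓝 o, f (τ (ψ p)) ∈ ψ.source := by
    have h₃ : ContinuousAt (fun p ↦ f (τ (ψ p))) o :=
      (hfs.continuous.continuousAt).comp hτψ.continuousAt
    refine h₃.eventually (p := fun q ↦ q ∈ ψ.source) ?_
    change ∀ᶠ q in 𝓝 (f (τ (ψ o))), q ∈ ψ.source
    rw [hτ0, hf0]
    exact extChartAt_source_mem_nhds _
  have h₃ : ∀ᶠ p in 𝓝 o, p ∈ ψ.source := extChartAt_source_mem_nhds _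
  filter_upwards [h₁, h₂, h₃] with p h₁ h₂ h₃
  exact ψ.injOn h₂ h₃ h₁

omit [FiniteDimensional ℝ E'] [ChartedSpace E' M] hact [IsManifold 𝓘(ℝ, E') ∞ M]
  [CompleteSpace E] in
/-- The analytic subgroup of `k` is normalized by every `b` with `Ad b k ⊆ k`. -/
theorem conj_mem_analyticSubgroup {k : Submodule ℝ (GroupLieAlgebra 𝓘(ℝ, E) G)} {b : G}
    (hb : ∀ x ∈ k, Ad b x ∈ k) {a : G} (ha : a ∈ analyticSubgroup k) :
    b * a * b⁻¹ ∈ analyticSubgroup k := by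
  induction ha using analyticSubgroup_induction with
  | exp x hx γ hγ t => exact (hγ.conj b).mem_analyticSubgroup (hb x hx) t
  | one => simp
  | mul a a' _ _ ha ha' =>
    have := mul_mem ha ha'
    rwa [conj_mul] at this

include hact in
omit [CompleteSpace E] [FiniteDimensional ℝ E'] [LieGroup 𝓘(ℝ, E) ∞ G] [IsManifold 𝓘(ℝ, E') ∞ M] in
/-- A subgroup `K` acts transitively on the connected manifold `M` if the orbit `K o` is a
neighbourhood of `o` and every point of `M` is the image of `o` under an element that normalizes
`K`: all orbits of `K` are then open. -/
theorem isPretransitive_of_normalizing [ConnectedSpace M] {o : M} {K : Subgroup G}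
    (hK : ∀ᶠ q in 𝓝 o, ∃ a ∈ K, a • o = q)
    (hn : ∀ p : M, ∃ b : G, b • o = p ∧ ∀ a ∈ K, b * a * b⁻¹ ∈ K) :
    MulAction.IsPretransitive K M := by
  have hopen (p : M) : IsOpen (MulAction.orbit K p) := by
    refine isOpen_iff_mem_nhds.2 fun q hq ↦ ?_
    rw [← MulAction.orbit_eq_iff.2 hq]
    obtain ⟨b, hb, hbK⟩ := hn q
    have hc : ContinuousAt (fun r : M ↦ b⁻¹ • r) q :=
      (contMDiff_smul_point (E := E) (E' := E') b⁻¹).continuous.continuousAt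
    have h₁ : ∀ᶠ r in 𝓝 q, ∃ a ∈ K, a • o = b⁻¹ • r := by
      refine hc.eventually (p := fun r ↦ ∃ a ∈ K, a • o = r) ?_
      beta_reduce
      rwa [← hb, inv_smul_smul]
    filter_upwards [h₁] with r hr
    obtain ⟨a, ha, har⟩ := hr
    refine ⟨⟨b * a * b⁻¹, hbK a ha⟩, ?_⟩
    change (b * a * b⁻¹) • q = r
    rw [← hb, mul_smul, inv_smul_smul, mul_smul, har, smul_inv_smul]
  have hclopen (p : M) : IsClopen (MulAction.orbit K p) := by
    -- The complement of an orbit is a union of orbits.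
    refine ⟨⟨?_⟩, hopen p⟩
    have : (MulAction.orbit K p)ᶜ = ⋃ q ∈ (MulAction.orbit K p)ᶜ, MulAction.orbit K q := by
      ext q
      simp only [Set.mem_iUnion, exists_prop]
      refine ⟨fun hq ↦ ⟨q, hq, MulAction.mem_orbit_self q⟩, ?_⟩
      rintro ⟨r, hr, hq⟩ hq'
      exact hr ((MulAction.orbit_eq_iff.2 hq').symm.trans (MulAction.orbit_eq_iff.2 hq) ▸
        MulAction.mem_orbit_self r)
    rw [this]
    exact isOpen_biUnion fun q _ ↦ hopen q
  refine ⟨fun p q ↦ ?_⟩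
  have h₁ := (hclopen p).eq_univ ⟨p, MulAction.mem_orbit_self p⟩
  exact (h₁ ▸ Set.mem_univ q : q ∈ MulAction.orbit K p)

/-- The subgroup generated by all one-parameter subgroups is transitive. -/
theorem isPretransitive_analyticSubgroup_top [ConnectedSpace M] {o : M}
    (hM : IsHomogeneousSpace E E' G o) :
    MulAction.IsPretransitive
      (analyticSubgroup (⊤ : Submodule ℝ (GroupLieAlgebra 𝓘(ℝ, E) G))) M := by
  obtain ⟨σ, -, hσ, hσo⟩ := exists_local_section (E' := E') (o := o)
    (k := (⊤ : Submodule ℝ (GroupLieAlgebra 𝓘(ℝ, E) G)))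
    fun v : E' ↦ let ⟨x, hx⟩ := hM.submersion v; ⟨x, Submodule.mem_top, hx⟩
  refine isPretransitive_of_normalizing (E := E) (E' := E') (hσo.mono fun q hq ↦ ⟨_, hσ q, hq⟩)
    fun p ↦ ?_
  obtain ⟨b, hb⟩ := hM.transitive.exists_smul_eq o p
  exact ⟨b, hb, fun a ha ↦ conj_mem_analyticSubgroup (fun _ _ ↦ Submodule.mem_top) ha⟩

/-- The analytic subgroup of an ideal that is mapped onto `T_o M` is transitive. -/
theorem isPretransitive_analyticSubgroup [FiniteDimensional ℝ E] [ConnectedSpace M] {o : M}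
    (hM : IsHomogeneousSpace E E' G o) {k : Submodule ℝ (GroupLieAlgebra 𝓘(ℝ, E) G)}
    (hk : ∀ v : E', ∃ x ∈ k, (orbitDeriv (E' := E') E G o x : E') = v)
    (hid : ∀ x : GroupLieAlgebra 𝓘(ℝ, E) G, ∀ y ∈ k, ⁅x, y⁆ ∈ k) :
    MulAction.IsPretransitive (analyticSubgroup k) M := by
  obtain ⟨σ, -, hσ, hσo⟩ := exists_local_section (o := o) hk
  refine isPretransitive_of_normalizing (E := E) (E' := E') (hσo.mono fun q hq ↦ ⟨_, hσ q, hq⟩)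
    fun p ↦ ?_
  obtain ⟨⟨b, hbG⟩, hb⟩ := (isPretransitive_analyticSubgroup_top hM).exists_smul_eq o p
  exact ⟨b, hb, fun a ha ↦ conj_mem_analyticSubgroup
    (fun x hx ↦ Ad_mem_of_mem_analyticSubgroup (fun y _ ↦ hid y) hbG hx) ha⟩

include hact in
/-- For an almost effective action, a subspace of the isotropy algebra that is normalized by the
Lie algebra of a transitive analytic subgroup is zero: its one-parameter subgroups fix all points
of `M`. -/
theorem eq_zero_of_isAlmostEffective [FiniteDimensional ℝ E] [T2Space M] {o : M}
    (hG : IsAlmostEffective G M) {k k' : Submodule ℝ (GroupLieAlgebra 𝓘(ℝ, E) G)}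
    (ht : MulAction.IsPretransitive (analyticSubgroup k') M)
    (hk : k ≤ isotropyAlgebra E G o) (hk' : ∀ x ∈ k', ∀ y ∈ k, ⁅x, y⁆ ∈ k)
    {x : GroupLieAlgebra 𝓘(ℝ, E) G} (hx : x ∈ k) : x = 0 := by
  have : CompleteSpace E' := FiniteDimensional.complete ℝ E'
  obtain ⟨γ, hγ⟩ := exists_isOneParameterSubgroup x
  have htriv (t : ℝ) (p : M) : γ t • p = p := by
    obtain ⟨⟨a, ha⟩, hap⟩ := ht.exists_smul_eq o p
    have h₁ := (hγ.conj a⁻¹).smul_eq (isotropyAlgebra_le_ker (E' := E')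
      (hk (Ad_mem_of_mem_analyticSubgroup hk' (inv_mem ha) hx))) t
    rw [inv_inv, mul_smul, mul_smul, inv_smul_eq_iff] at h₁
    rw [← hap]
    exact h₁
  let δ : ℝ → {a : G | ∀ p : M, a • p = p} := fun t ↦ ⟨γ t, htriv t⟩
  have hδ : Continuous δ := hγ.smooth.continuous.subtype_mk _
  have : DiscreteTopology {a : G | ∀ p : M, a • p = p} := hG
  have hconst (t : ℝ) : γ t = 1 := by
    rw [← hγ.map_zero]
    exact congrArg Subtype.val (PreconnectedSpace.constant (inferInstance : PreconnectedSpace ℝ) hδ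
      (x := t) (y := 0))
  rw [← hγ.velocity_eq, funext hconst, velocity_const]

end Sections

/-! ### Invariant metrics -/

section InvariantMetrics

open Filter Topology

variable {E : Type*} [NormedAddCommGroup E] [NormedSpace ℝ E]
  {E' : Type*} [NormedAddCommGroup E'] [NormedSpace ℝ E']
  {G : Type*} [TopologicalSpace G] [ChartedSpace E G] [Group G]
  {M : Type*} [TopologicalSpace M] [ChartedSpace E' M] [IsManifold 𝓘(ℝ, E') ∞ M] [MulAction G M]

omit [MulAction G M] in
/-- A field of bilinear forms is smooth at `p₀` if in the trivialization of the tangent bundle at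
`p₀` it is the pull-back of a fixed form by a smooth family of linear maps. -/
theorem contMDiffAt_bilinear_field {p₀ : M} {g : (p : M) → TangentSpace 𝓘(ℝ, E') p →L[ℝ]
      TangentSpace 𝓘(ℝ, E') p →L[ℝ] ℝ}
    (B : E' →L[ℝ] E' →L[ℝ] ℝ) {C : M → E' →L[ℝ] E'}
    (hC : ContMDiffAt 𝓘(ℝ, E') 𝓘(ℝ, E' →L[ℝ] E') ∞ C p₀)
    (h : ∀ᶠ p in 𝓝 p₀, ∀ v w : E',
      g p ((trivializationAt E' (TangentSpace 𝓘(ℝ, E')) p₀).symm p v)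
        ((trivializationAt E' (TangentSpace 𝓘(ℝ, E')) p₀).symm p w) = B (C p v) (C p w)) :
    ContMDiffAt 𝓘(ℝ, E') (𝓘(ℝ, E').prod 𝓘(ℝ, E' →L[ℝ] E' →L[ℝ] ℝ)) ∞
    (fun p : M ↦ Bundle.TotalSpace.mk' (E' →L[ℝ] E' →L[ℝ] ℝ)
      (E := fun p : M ↦ TangentSpace 𝓘(ℝ, E') p →L[ℝ] TangentSpace 𝓘(ℝ, E') p →L[ℝ] ℝ)
      p (g p)) p₀ := by
  have : IsManifold 𝓘(ℝ, E') 1 M := .of_le (n := ∞) (by simp)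
  rw [contMDiffAt_hom_bundle]
  refine ⟨contMDiffAt_id, ?_⟩
  have h₁ : ContMDiffAt 𝓘(ℝ, E') 𝓘(ℝ, E' →L[ℝ] E' →L[ℝ] ℝ) ∞
      (fun p ↦ (((B.comp (C p)).flip).comp (C p)).flip) p₀ := by
    have h₂ : ContDiff ℝ ∞ (fun c : E' →L[ℝ] E' ↦ (((B.comp c).flip).comp c).flip) := by
      have hf : ContDiff ℝ ∞ (fun D : E' →L[ℝ] E' →L[ℝ] ℝ ↦ D.flip) :=
        show ContDiff ℝ ∞ (ContinuousLinearMap.flipₗᵢ ℝ E' E' ℝ) from LinearIsometryEquiv.contDiff _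
      exact hf.comp ((hf.comp (contDiff_const.clm_comp contDiff_id)).clm_comp contDiff_id)
    exact h₂.contMDiff.contMDiffAt.comp p₀ hC
  refine h₁.congr_of_eventuallyEq ?_
  have hb : ∀ᶠ p in 𝓝 p₀, p ∈ (trivializationAt E' (TangentSpace 𝓘(ℝ, E')) p₀).baseSet :=
    (trivializationAt E' (TangentSpace 𝓘(ℝ, E')) p₀).open_baseSet.mem_nhds
      (FiberBundle.mem_baseSet_trivializationAt' p₀)
  filter_upwards [h, hb] with p hp hpb
  ext v w
  refine Eq.trans (inCoordinates_apply_eq₂ (E₃ := fun _ : M ↦ ℝ) (F₃ := ℝ) hpb hpb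
    (Set.mem_univ _)) ?_
  refine Eq.trans ?_ (hp v w)
  simp

/-- If `τ` is a smooth local section of an orbit map, so that `τ p` maps `o` to `p`, then the
differential of `τ p⁻¹` at `p` depends smoothly on `p`. -/
theorem contMDiffAt_mfderiv_section [hact : ContMDiffSMul 𝓘(ℝ, E) 𝓘(ℝ, E') ∞ G M]
    [LieGroup 𝓘(ℝ, E) ∞ G] {o p₀ : M} {τ : M → G}
    (hτ : ContMDiffAt 𝓘(ℝ, E') 𝓘(ℝ, E) ∞ τ p₀) (hτo : ∀ᶠ p in 𝓝 p₀, τ p • o = p) :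
    ∃ C : M → E' →L[ℝ] E', ContMDiffAt 𝓘(ℝ, E') 𝓘(ℝ, E' →L[ℝ] E') ∞ C p₀ ∧
      ∀ᶠ p in 𝓝 p₀, ∀ v : E', C p v =
        (mfderiv 𝓘(ℝ, E') 𝓘(ℝ, E') (fun q : M ↦ (τ p)⁻¹ • q) p : E' →L[ℝ] E')
          ((trivializationAt E' (TangentSpace 𝓘(ℝ, E')) p₀).symm p v) := by
  have : IsManifold 𝓘(ℝ, E') 1 M := .of_le (n := ∞) (by simp)
  have h₁ : ContMDiffAt (𝓘(ℝ, E').prod 𝓘(ℝ, E')) 𝓘(ℝ, E') ∞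
      (Function.uncurry fun p q : M ↦ (τ p)⁻¹ • q) (p₀, id p₀) := by
    have h₂ : ContMDiffAt (𝓘(ℝ, E').prod 𝓘(ℝ, E')) 𝓘(ℝ, E) ∞
        (fun x : M × M ↦ (τ x.1)⁻¹) (p₀, p₀) := by
      have h₃ : ContMDiffAt 𝓘(ℝ, E') 𝓘(ℝ, E) ∞ (fun p ↦ (τ p)⁻¹) p₀ := hτ.inv
      exact ContMDiffAt.comp (p₀, p₀) (f := Prod.fst) h₃ contMDiffAt_fst
    exact (hact.contMDiff_smul.contMDiffAt).comp (p₀, p₀) (h₂.prodMk contMDiffAt_snd)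
  have h₂ := ContMDiffAt.mfderiv (m := ∞) (n := ∞) (fun p q : M ↦ (τ p)⁻¹ • q) id h₁
    contMDiffAt_id (by simp)
  refine ⟨_, h₂, ?_⟩
  have hs : ∀ᶠ p in 𝓝 p₀, p ∈ (chartAt E' p₀).source := chart_source_mem_nhds _ _
  have ho {p : M} (hp : τ p • o = p) : (τ p)⁻¹ • p = o := by rw [inv_smul_eq_iff, hp]
  filter_upwards [hs, hτo] with p hp hpo
  intro v
  have h₀ := ho hτo.self_of_nhds
  have h₃ := inTangentCoordinates_eq (I := 𝓘(ℝ, E')) (I' := 𝓘(ℝ, E')) (f := id)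
    (g := fun p : M ↦ (τ p)⁻¹ • p) (x₀ := p₀) (x := p)
    (fun p ↦ mfderiv 𝓘(ℝ, E') 𝓘(ℝ, E') (fun q : M ↦ (τ p)⁻¹ • q) p) hp (by
      rw [h₀, ho hpo]; exact mem_chart_source _ _)
  refine (DFunLike.congr_fun h₃ v).trans ?_
  have h₄ : (trivializationAt E' (TangentSpace 𝓘(ℝ, E')) p₀).symm p v =
      (tangentBundleCore 𝓘(ℝ, E') M).coordChange (achart E' p₀) (achart E' p) p v :=
    (Bundle.Trivialization.symmL_apply (R := ℝ) _ hp v).symm.trans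
      (DFunLike.congr_fun (TangentBundle.symmL_trivializationAt_eq_core (I := 𝓘(ℝ, E')) hp) v)
  -- As `τ p⁻¹ • p = o`, no change of coordinates occurs in the target.
  rw [h₀, ho hpo]
  refine ((tangentBundleCore 𝓘(ℝ, E') M).coordChange_self (achart E' o) o
    (mem_chart_source _ _) _).trans ?_
  exact congrArg _ h₄.symm

variable [hact : ContMDiffSMul 𝓘(ℝ, E) 𝓘(ℝ, E') ∞ G M]

omit [IsManifold 𝓘(ℝ, E') ∞ M] in
include hact in
theorem mfderiv_inv_smul_smul (a : G) (p : M) (v : E') :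
    (mfderiv 𝓘(ℝ, E') 𝓘(ℝ, E') (fun q : M ↦ a⁻¹ • q) (a • p) : E' →L[ℝ] E')
      ((mfderiv 𝓘(ℝ, E') 𝓘(ℝ, E') (fun q : M ↦ a • q) p : E' →L[ℝ] E') v) = v := by
  rw [← mfderiv_smul_smul (E := E), inv_mul_cancel]
  exact mfderiv_one_smul p v

/-- A nondegenerate symmetric bilinear form on `T_o M` that is invariant under the isotropy group
extends to an invariant metric: at `p` it is the pull-back by any group element that maps `p`
to `o`. -/
theorem exists_isInvariant [CompleteSpace E] [FiniteDimensional ℝ E'] [LieGroup 𝓘(ℝ, E) ∞ G]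
    {o : M} (hM : IsHomogeneousSpace E E' G o) (B : E' →L[ℝ] E' →L[ℝ] ℝ)
    (hsymm : ∀ v w, B v w = B w v) (hnd : ∀ v, (∀ w, B v w = 0) → v = 0)
    (hinv : ∀ a ∈ MulAction.stabilizer G o, ∀ v w : E',
      B ((mfderiv 𝓘(ℝ, E') 𝓘(ℝ, E') (fun q : M ↦ a • q) o : E' →L[ℝ] E') v)
        ((mfderiv 𝓘(ℝ, E') 𝓘(ℝ, E') (fun q : M ↦ a • q) o : E' →L[ℝ] E') w) = B v w) :
    ∃ met : PseudoRiemannianMetric E' M, met.IsInvariant G ∧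
      ∀ v w : E', (met.inner o v w : ℝ) = B v w := by
  let D (a : G) (p : M) : E' →L[ℝ] E' := mfderiv 𝓘(ℝ, E') 𝓘(ℝ, E') (fun q : M ↦ a • q) p
  have hD (a b : G) (p : M) (v : E') : D (a * b) p v = D a (b • p) (D b p v) :=
    mfderiv_smul_smul (E := E) a b p v
  have hD1 (a : G) (p : M) (v : E') : D a⁻¹ (a • p) (D a p v) = v :=
    mfderiv_inv_smul_smul (E := E) a p v
  choose β hβ using fun p ↦ hM.transitive.exists_smul_eq o p
  have hβ' (p : M) : (β p)⁻¹ • p = o := by rw [inv_smul_eq_iff, hβ]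
  let g (p : M) : E' →L[ℝ] E' →L[ℝ] ℝ := B.bilinearComp (D (β p)⁻¹ p) (D (β p)⁻¹ p)
  have hg (p : M) (v w : E') : g p v w = B (D (β p)⁻¹ p v) (D (β p)⁻¹ p w) := rfl
  -- By invariance under the isotropy group the choice of `β p` does not matter.
  have hkey {b : G} {p : M} (hb : b • o = p) (v w : E') :
      g p v w = B (D b⁻¹ p v) (D b⁻¹ p w) := by
    have h₁ (v : E') : D b⁻¹ p v = D (b⁻¹ * β p) o (D (β p)⁻¹ p v) := by
      have h₂ := hD (b⁻¹ * β p) (β p)⁻¹ p v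
      rwa [mul_inv_cancel_right, hβ'] at h₂
    have h₂ : b⁻¹ * β p ∈ MulAction.stabilizer G o := by
      rw [MulAction.mem_stabilizer_iff, mul_smul, hβ, inv_smul_eq_iff, hb]
    rw [h₁, h₁, hg]
    exact (hinv _ h₂ _ _).symm
  have hsmooth (p₀ : M) : ContMDiffAt 𝓘(ℝ, E') (𝓘(ℝ, E').prod 𝓘(ℝ, E' →L[ℝ] E' →L[ℝ] ℝ)) ∞
      (fun p : M ↦ Bundle.TotalSpace.mk' (E' →L[ℝ] E' →L[ℝ] ℝ)
        (E := fun p : M ↦ TangentSpace 𝓘(ℝ, E') p →L[ℝ] TangentSpace 𝓘(ℝ, E') p →L[ℝ] ℝ)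
        p (g p)) p₀ := by
    obtain ⟨σ, hσ, -, hσo⟩ := exists_local_section (E' := E') (o := o)
      (k := (⊤ : Submodule ℝ (GroupLieAlgebra 𝓘(ℝ, E) G)))
      fun v : E' ↦ let ⟨x, hx⟩ := hM.submersion v; ⟨x, Submodule.mem_top, hx⟩
    have h₁ : ContMDiff 𝓘(ℝ, E') 𝓘(ℝ, E') ∞ (fun p : M ↦ (β p₀)⁻¹ • p) :=
      contMDiff_smul_point (E := E) _
    have h₂ : ContMDiffAt 𝓘(ℝ, E') 𝓘(ℝ, E) ∞ (fun p ↦ β p₀ * σ ((β p₀)⁻¹ • p)) p₀ := by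
      have h₃ : ContMDiffAt 𝓘(ℝ, E') 𝓘(ℝ, E) ∞ (fun p ↦ σ ((β p₀)⁻¹ • p)) p₀ := by
        refine ContMDiffAt.comp p₀ (g := σ) ?_ h₁.contMDiffAt
        rw [hβ']; exact hσ
      exact contMDiffAt_const.mul h₃
    have h₃ : ∀ᶠ p in 𝓝 p₀, (β p₀ * σ ((β p₀)⁻¹ • p)) • o = p := by
      have h₄ : ∀ᶠ p in 𝓝 p₀, σ ((β p₀)⁻¹ • p) • o = (β p₀)⁻¹ • p := by
        refine h₁.continuous.continuousAt.eventually (p := fun q ↦ σ q • o = q) ?_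
        beta_reduce
        rwa [hβ']
      filter_upwards [h₄] with p hp
      rw [mul_smul, hp, smul_inv_smul]
    obtain ⟨C, hC, hCp⟩ := contMDiffAt_mfderiv_section h₂ h₃
    refine contMDiffAt_bilinear_field B hC ?_
    filter_upwards [h₃, hCp] with p hp hCp v w
    rw [hCp, hCp]
    exact hkey hp _ _
  refine ⟨⟨g, fun p v w ↦ hsymm _ _, fun p v hv ↦ ?_, hsmooth⟩, fun a p v w ↦ ?_, fun v w ↦ ?_⟩
  · have h₁ : D (β p)⁻¹ p v = 0 := by
      refine hnd _ fun w ↦ ?_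
      have h₂ := hD1 (β p) o w
      have h₃ := hv (D (β p) o w)
      rw [hβ] at h₂
      exact (congrArg (B (D (β p)⁻¹ p v)) h₂).symm.trans h₃
    have h₂ := hD1 (β p)⁻¹ p v
    rw [h₁, map_zero] at h₂
    exact h₂.symm
  · have h₁ : (a * β p) • o = a • p := by rw [mul_smul, hβ]
    refine (hkey h₁ (D a p v) (D a p w)).trans ?_
    have h₂ (v : E') : D (a * β p)⁻¹ (a • p) (D a p v) = D (β p)⁻¹ p v := by
      rw [← hD, mul_inv_rev, inv_mul_cancel_right]
    exact congrArg₂ (fun x y ↦ B x y) (h₂ v) (h₂ w)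
  · refine (hkey (one_smul G o) v w).trans ?_
    have h₁ (v : E') : D (1 : G)⁻¹ o v = v := by rw [inv_one]; exact mfderiv_one_smul o v
    rw [h₁, h₁]

include hact in
/-- An invariant metric is determined by its value at one point. -/
theorem PseudoRiemannianMetric.IsInvariant.eq_of_inner_eq {met met' : PseudoRiemannianMetric E' M}
    (h : met.IsInvariant G) (h' : met'.IsInvariant G) (ht : MulAction.IsPretransitive G M) {o : M}
    (ho : ∀ v w, met.inner o v w = met'.inner o v w) : met = met' := by
  have h₁ : met.inner = met'.inner := by
    funext p
    obtain ⟨a, rfl⟩ := ht.exists_smul_eq o p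
    have hs (v : TangentSpace 𝓘(ℝ, E') (a • o)) : ∃ v' : TangentSpace 𝓘(ℝ, E') o,
        mfderiv 𝓘(ℝ, E') 𝓘(ℝ, E') (fun q : M ↦ a • q) o v' = v := by
      have h₂ := mfderiv_inv_smul_smul (E := E) (E' := E') a⁻¹ (a • o) v
      rw [inv_inv, inv_smul_smul] at h₂
      exact ⟨_, h₂⟩
    ext v w
    obtain ⟨v, rfl⟩ := hs v
    obtain ⟨w, rfl⟩ := hs w
    exact (h a o v w).trans ((ho v w).trans (h' a o v w).symm)
  cases met
  cases met'
  cases h₁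
  rfl

end InvariantMetrics

/-! ### Isotropy representation and naturally reductive pairs -/

section NaturallyReductiveSpaces

variable {E : Type*} [NormedAddCommGroup E] [NormedSpace ℝ E]
  {E' : Type*} [NormedAddCommGroup E'] [NormedSpace ℝ E']
  {G : Type*} [TopologicalSpace G] [ChartedSpace E G] [Group G] [LieGroup 𝓘(ℝ, E) ∞ G]
  {M : Type*} [TopologicalSpace M] [ChartedSpace E' M] [MulAction G M]

theorem Ad_mem_lieAlgebraOf {H : Subgroup G} {a : G} (ha : a ∈ H)
    {x : GroupLieAlgebra 𝓘(ℝ, E) G} (hx : x ∈ lieAlgebraOf H) : Ad a x ∈ lieAlgebraOf H := by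
  obtain ⟨γ, hγ, h0, hH, rfl⟩ := hx
  exact ⟨fun t ↦ a * γ t * a⁻¹, (contMDiff_const.mul hγ).mul contMDiff_const, by simp [h0],
    fun t ↦ mul_mem (mul_mem ha (hH t)) (inv_mem ha), velocity_conj hγ h0 a⟩

theorem lieAlgebraOf_mono {H K : Subgroup G} (h : H ≤ K) :
    lieAlgebraOf (E := E) H ≤ lieAlgebraOf K := by
  rintro _ ⟨γ, hγ, h0, hH, rfl⟩
  exact ⟨γ, hγ, h0, fun t ↦ h (hH t), rfl⟩

/-- The metric pulled back to the Lie algebra by `g → T_o M`, as a bilinear form. -/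
def metricForm (E : Type*) [NormedAddCommGroup E] [NormedSpace ℝ E]
    {E' : Type*} [NormedAddCommGroup E'] [NormedSpace ℝ E']
    (G : Type*) [TopologicalSpace G] [ChartedSpace E G] [Group G]
    {M : Type*} [TopologicalSpace M] [ChartedSpace E' M] [MulAction G M]
    [IsManifold 𝓘(ℝ, E') ∞ M] (met : PseudoRiemannianMetric E' M) (o : M) :
    LinearMap.BilinForm ℝ (GroupLieAlgebra 𝓘(ℝ, E) G) :=
  LinearMap.mk₂ ℝ (metricAt E G met o) (fun x y z ↦ by simp [metricAt])
    (fun c x y ↦ by simp [metricAt]) (fun x y z ↦ by simp [metricAt])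
    (fun c x y ↦ by simp [metricAt])

variable [FiniteDimensional ℝ E] [FiniteDimensional ℝ E'] [IsManifold 𝓘(ℝ, E') ∞ M] [T2Space M]
  {o : M}

/-- The isotropy algebra consists of the velocities of one-parameter subgroups of the isotropy
group. -/
theorem exists_isOneParameterSubgroup_stabilizer (hM : IsHomogeneousSpace E E' G o)
    {x : GroupLieAlgebra 𝓘(ℝ, E) G} (hx : x ∈ isotropyAlgebra E G o) :
    ∃ γ : ℝ → G, IsOneParameterSubgroup γ x ∧ ∀ t, γ t ∈ MulAction.stabilizer G o := by
  have := FiniteDimensional.complete ℝ E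
  have := FiniteDimensional.complete ℝ E'
  have := hM.smooth
  obtain ⟨γ, hγ⟩ := exists_isOneParameterSubgroup x
  exact ⟨γ, hγ, fun t ↦ hγ.smul_eq (isotropyAlgebra_le_ker (E' := E') hx) t⟩

theorem lie_mem_isotropyAlgebra (hM : IsHomogeneousSpace E E' G o)
    {x y : GroupLieAlgebra 𝓘(ℝ, E) G} (hx : x ∈ isotropyAlgebra E G o)
    (hy : y ∈ isotropyAlgebra E G o) :
    (⁅x, y⁆ : GroupLieAlgebra 𝓘(ℝ, E) G) ∈ isotropyAlgebra E G o := by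
  obtain ⟨γ, hγ, hγo⟩ := exists_isOneParameterSubgroup_stabilizer hM hx
  exact hγ.lie_mem fun t ↦ Ad_mem_lieAlgebraOf (hγo t) hy

theorem IsReductiveDecomposition.lie_mem (hM : IsHomogeneousSpace E E' G o)
    {m : Submodule ℝ (GroupLieAlgebra 𝓘(ℝ, E) G)} (hm : IsReductiveDecomposition o m)
    {x y : GroupLieAlgebra 𝓘(ℝ, E) G} (hx : x ∈ isotropyAlgebra E G o) (hy : y ∈ m) :
    (⁅x, y⁆ : GroupLieAlgebra 𝓘(ℝ, E) G) ∈ m := by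
  obtain ⟨γ, hγ, hγo⟩ := exists_isOneParameterSubgroup_stabilizer hM hx
  exact hγ.lie_mem fun t ↦ hm.ad_mem _ (hγo t) y hy

omit [FiniteDimensional ℝ E] [FiniteDimensional ℝ E'] [IsManifold 𝓘(ℝ, E') ∞ M] [T2Space M] in
/-- The projection to `m` along `h` does not change the image in `T_o M`. -/
theorem orbitDeriv_projection (hM : IsHomogeneousSpace E E' G o)
    {m : Submodule ℝ (GroupLieAlgebra 𝓘(ℝ, E) G)} (hc : IsCompl m (isotropyAlgebra E G o))
    (x : GroupLieAlgebra 𝓘(ℝ, E) G) :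
    orbitDeriv (E' := E') E G o (m.projection (isotropyAlgebra E G o) hc x) =
      orbitDeriv (E' := E') E G o x := by
  have := hM.smooth
  have h₁ : x - m.projection (isotropyAlgebra E G o) hc x ∈ isotropyAlgebra E G o :=
    Submodule.sub_projection_mem hc x
  have h₂ := isotropyAlgebra_le_ker (E' := E') h₁
  rw [map_sub] at h₂
  exact (sub_eq_zero.1 h₂).symm

omit [FiniteDimensional ℝ E] [FiniteDimensional ℝ E'] [IsManifold 𝓘(ℝ, E') ∞ M] [T2Space M] in
/-- A complement of the isotropy algebra is mapped onto `T_o M`. -/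
theorem exists_mem_orbitDeriv_eq (hM : IsHomogeneousSpace E E' G o)
    {m : Submodule ℝ (GroupLieAlgebra 𝓘(ℝ, E) G)} (hc : IsCompl m (isotropyAlgebra E G o))
    (v : TangentSpace 𝓘(ℝ, E') o) : ∃ x ∈ m, orbitDeriv E G o x = v := by
  obtain ⟨x, rfl⟩ := hM.submersion v
  exact ⟨_, Submodule.projection_apply_mem hc x, orbitDeriv_projection hM hc x⟩

omit [FiniteDimensional ℝ E] [FiniteDimensional ℝ E'] [T2Space M] in
/-- An invariant metric, pulled back to the Lie algebra, is invariant under the isotropy group. -/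
theorem metricForm_Ad (hM : IsHomogeneousSpace E E' G o) {met : PseudoRiemannianMetric E' M}
    (hinv : met.IsInvariant G) {a : G} (ha : a ∈ MulAction.stabilizer G o)
    (x y : GroupLieAlgebra 𝓘(ℝ, E) G) :
    metricForm E G met o (Ad a x) (Ad a y) = metricForm E G met o x y := by
  have := hM.smooth
  have h₁ (p : M) (hp : p = o) (v w : E') : (met.inner p v w : ℝ) = met.inner o v w := by
    subst hp; rfl
  refine Eq.trans ?_ (hinv a o (orbitDeriv E G o x) (orbitDeriv E G o y))
  refine Eq.trans ?_ (h₁ (a • o) ha _ _).symm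
  exact congrArg₂ (fun v w : E' ↦ (met.inner o v w : ℝ)) (orbitDeriv_Ad (E' := E') ha x)
    (orbitDeriv_Ad (E' := E') ha y)

/-- A naturally reductive decomposition gives the algebraic data from which Kostant's form is
built; the isotropy group acts by isometries of `T_o M`, so that `ad h` is skew. -/
theorem isNaturallyReductivePair (hM : IsHomogeneousSpace E E' G o)
    {met : PseudoRiemannianMetric E' M} (hinv : met.IsInvariant G)
    {m : Submodule ℝ (GroupLieAlgebra 𝓘(ℝ, E) G)}
    (hm : IsNaturallyReductiveDecomposition met o m) :
    have := FiniteDimensional.complete ℝ E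
    IsNaturallyReductivePair (isotropyAlgebra E G o) m (metricForm E G met o) := by
  have := FiniteDimensional.complete ℝ E
  have := hM.smooth
  exact {
    isCompl := hm.isCompl
    lie_h_m := fun a ha x hx ↦ hm.toIsReductiveDecomposition.lie_mem hM ha hx
    lie_h_h := fun a ha b hb ↦ lie_mem_isotropyAlgebra hM ha hb
    symm := fun x y ↦ met.symm o _ _
    apply_h := fun a ha x ↦ by
      have h₁ := isotropyAlgebra_le_ker (E' := E') ha
      refine (congrArg (fun v ↦ met.inner o v (orbitDeriv E G o x)) h₁).trans ?_
      exact DFunLike.congr_fun (ContinuousLinearMap.map_zero (met.inner o)) _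
    skew_m := fun x hx y hy z hz ↦ by
      have h₁ := hm.skew x hx y hy z hz
      simp only [metricAt, orbitDeriv_projection hM] at h₁
      exact h₁
    skew_h := fun a ha y _ z _ ↦ by
      obtain ⟨γ, hγ, hγo⟩ := exists_isOneParameterSubgroup_stabilizer hM ha
      exact hγ.form_skew fun t ↦ metricForm_Ad hM hinv (hγo t) y z
    nondegenerate := fun x hx h ↦ by
      have := FiniteDimensional.complete ℝ E'
      have h₁ : orbitDeriv (E' := E') E G o x = 0 := by
        refine met.nondegenerate o _ fun w ↦ ?_
        obtain ⟨y, hy, rfl⟩ := exists_mem_orbitDeriv_eq hM hm.isCompl w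
        exact h y hy
      exact Submodule.disjoint_def.1 hm.isCompl.disjoint x hx
        ((mem_isotropyAlgebra_iff (E := E) (E' := E') (G := G) (o := o)).2 h₁) }

theorem lie_mem_addBracket (hM : IsHomogeneousSpace E E' G o)
    {m : Submodule ℝ (GroupLieAlgebra 𝓘(ℝ, E) G)} (hm : IsReductiveDecomposition o m)
    (x : GroupLieAlgebra 𝓘(ℝ, E) G) {y : GroupLieAlgebra 𝓘(ℝ, E) G} (hy : y ∈ addBracket m) :
    (⁅x, y⁆ : GroupLieAlgebra 𝓘(ℝ, E) G) ∈ addBracket m := by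
  have := FiniteDimensional.complete ℝ E
  exact lie_mem_lieAddBracket_of_codisjoint hm.isCompl.sup_eq_top
    (fun a ha x hx ↦ hm.lie_mem hM ha hx) x hy

theorem isPretransitive_addBracket [ConnectedSpace M] (hM : IsHomogeneousSpace E E' G o)
    {m : Submodule ℝ (GroupLieAlgebra 𝓘(ℝ, E) G)} (hm : IsReductiveDecomposition o m) :
    MulAction.IsPretransitive (analyticSubgroup (addBracket m)) M := by
  have := FiniteDimensional.complete ℝ E
  have := hM.smooth
  refine isPretransitive_analyticSubgroup hM (fun v ↦ ?_) fun x y ↦ lie_mem_addBracket hM hm x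
  obtain ⟨x, hx, hv⟩ := exists_mem_orbitDeriv_eq hM hm.isCompl v
  exact ⟨x, Submodule.mem_sup_left hx, hv⟩

/-- For `x ∈ h ∩ k` the curve `exp (t x)` stays both in the isotropy group and in the analytic
subgroup of `k`. -/
theorem lieAlgebraOf_stabilizer_inf_analyticSubgroup (hM : IsHomogeneousSpace E E' G o)
    (k : Submodule ℝ (GroupLieAlgebra 𝓘(ℝ, E) G)) :
    lieAlgebraOf (MulAction.stabilizer G o ⊓ analyticSubgroup k) ⊓ k =
      isotropyAlgebra E G o ⊓ k := by
  refine le_antisymm (inf_le_inf_right _ (lieAlgebraOf_mono inf_le_left)) ?_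
  rintro x ⟨hx, hxk⟩
  obtain ⟨γ, hγ, hγo⟩ := exists_isOneParameterSubgroup_stabilizer hM hx
  exact ⟨⟨γ, hγ.smooth, hγ.map_zero, fun t ↦ ⟨hγo t, hγ.mem_analyticSubgroup hxk t⟩,
    hγ.velocity_eq⟩, hxk⟩

/-- Kostant's form: existence. Nondegeneracy uses that an element of `h ∩ (m + [m, m])` that
centralizes `m` also centralizes `m + [m, m]`, hence generates a one-parameter group acting
trivially on `M`. -/
theorem exists_form_addBracket [ConnectedSpace M] (hM : IsHomogeneousSpace E E' G o)
    (hG : IsAlmostEffective G M) {met : PseudoRiemannianMetric E' M} (hinv : met.IsInvariant G)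
    {m : Submodule ℝ (GroupLieAlgebra 𝓘(ℝ, E) G)}
    (hm : IsNaturallyReductiveDecomposition met o m) :
    ∃ Q : LinearMap.BilinForm ℝ (addBracket m),
      Q.IsSymm ∧ Q.Nondegenerate ∧
      IsAdInvariantOn (analyticSubgroup (addBracket m)) (addBracket m) Q ∧
      (∀ x y : addBracket m, (x : GroupLieAlgebra 𝓘(ℝ, E) G) ∈ isotropyAlgebra E G o →
        (y : GroupLieAlgebra 𝓘(ℝ, E) G) ∈ m → Q x y = 0) ∧
      (∀ x y : addBracket m, (x : GroupLieAlgebra 𝓘(ℝ, E) G) ∈ m →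
        (y : GroupLieAlgebra 𝓘(ℝ, E) G) ∈ m → Q x y = metricAt E G met o x y) := by
  have := FiniteDimensional.complete ℝ E
  have := hM.smooth
  have hr := hm.toIsReductiveDecomposition
  have H := isNaturallyReductivePair hM hinv hm
  obtain ⟨Q, h₁, h₂, h₃, h₄⟩ := H.exists_form
  have hid : ∀ x ∈ addBracket m, ∀ y ∈ addBracket m,
      (⁅x, y⁆ : GroupLieAlgebra 𝓘(ℝ, E) G) ∈ addBracket m :=
    fun x _ y hy ↦ lie_mem_addBracket hM hr x hy
  have hf : ∀ a ∈ isotropyAlgebra E G o ⊓ lieAddBracket m,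
      (∀ x ∈ m, (⁅a, x⁆ : GroupLieAlgebra 𝓘(ℝ, E) G) = 0) → a = 0 := by
    intro a ha ha0
    have hc : ∀ y ∈ lieAddBracket m, (⁅a, y⁆ : GroupLieAlgebra 𝓘(ℝ, E) G) = 0 := by
      intro y hy
      induction hy using lieAddBracket_induction with
      | mem x hx => exact ha0 x hx
      | lie x hx y hy => rw [leibniz_lie, ha0 x hx, ha0 y hy, zero_lie, lie_zero, add_zero]
      | add u v _ _ hu hv => rw [lie_add, hu, hv, add_zero]
      | smul c u _ hu => rw [lie_smul, hu, smul_zero]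
    refine eq_zero_of_isAlmostEffective (E' := E') (o := o) (k := ℝ ∙ a) hG
      (isPretransitive_addBracket hM hr) ?_ ?_ (Submodule.mem_span_singleton_self a)
    · rw [Submodule.span_singleton_le_iff_mem]; exact ha.1
    · intro x hx y hy
      obtain ⟨c, rfl⟩ := Submodule.mem_span_singleton.1 hy
      rw [lie_smul, ← lie_skew, hc x hx, neg_zero, smul_zero]
      exact zero_mem _
  have hnd (u : addBracket m) (h0 : ∀ v, Q.restrict (addBracket m) u v = 0) : u = 0 :=
    Subtype.ext (H.form_nondegenerate h₁ h₂ h₄ hf u.2 fun v hv ↦ h0 ⟨v, hv⟩)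
  refine ⟨Q.restrict (addBracket m), ⟨fun u v ↦ h₃ u u.2 v v.2⟩, ⟨hnd, fun v h0 ↦ hnd v fun u ↦ ?_⟩,
    fun a ha ↦ ⟨fun x hx ↦ Ad_mem_of_mem_analyticSubgroup hid ha hx, fun x y ↦ ?_⟩,
    fun x y hx hy ↦ h₂ x hx y hy, fun x y hx _ ↦ h₁ x hx y⟩
  · exact (h₃ v v.2 u u.2).trans (h0 u)
  · exact form_Ad_of_mem_analyticSubgroup hid
      (fun x hx u hu v hv ↦ H.form_skew h₁ h₂ h₃ h₄ hx hu hv) ha x.2 y.2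

/-- An `Ad`-invariant form on `k` is `ad`-invariant. -/
theorem IsAdInvariantOn.skew {k : Submodule ℝ (GroupLieAlgebra 𝓘(ℝ, E) G)}
    {Q : LinearMap.BilinForm ℝ k} (hQ : IsAdInvariantOn (analyticSubgroup k) k Q)
    {x : GroupLieAlgebra 𝓘(ℝ, E) G} (hx : x ∈ k) (v w : k)
    (hv : (⁅x, (v : GroupLieAlgebra 𝓘(ℝ, E) G)⁆ : GroupLieAlgebra 𝓘(ℝ, E) G) ∈ k)
    (hw : (⁅x, (w : GroupLieAlgebra 𝓘(ℝ, E) G)⁆ : GroupLieAlgebra 𝓘(ℝ, E) G) ∈ k) :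
    Q ⟨_, hv⟩ w + Q v ⟨_, hw⟩ = 0 := by
  have := FiniteDimensional.complete ℝ E
  -- Extend the form to the whole Lie algebra by a projection.
  obtain ⟨p, hp⟩ := k.subtype.exists_leftInverse_of_injective k.ker_subtype
  have hp' {u : GroupLieAlgebra 𝓘(ℝ, E) G} (hu : u ∈ k) : p u = ⟨u, hu⟩ :=
    LinearMap.congr_fun hp ⟨u, hu⟩
  obtain ⟨γ, hγ⟩ := exists_isOneParameterSubgroup x
  have h₁ := hγ.form_skew (Q := Q.compl₁₂ p p) (u := v) (v := w) fun t ↦ by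
    obtain ⟨hk, hQt⟩ := hQ (γ t) (hγ.mem_analyticSubgroup hx t)
    rw [LinearMap.compl₁₂_apply, LinearMap.compl₁₂_apply, hp' (hk _ v.2), hp' (hk _ w.2),
      hp' v.2, hp' w.2]
    exact hQt v w
  rwa [LinearMap.compl₁₂_apply, LinearMap.compl₁₂_apply, hp' hv, hp' hw, hp' v.2, hp' w.2] at h₁

/-- Kostant's form: uniqueness. -/
theorem form_addBracket_unique [CompleteSpace E] (hM : IsHomogeneousSpace E E' G o)
    {m : Submodule ℝ (GroupLieAlgebra 𝓘(ℝ, E) G)} (hm : IsReductiveDecomposition o m)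
    {Q Q' : LinearMap.BilinForm ℝ (lieAddBracket m)} (hs : Q.IsSymm) (hs' : Q'.IsSymm)
    (hi : IsAdInvariantOn (analyticSubgroup (lieAddBracket m)) (lieAddBracket m) Q)
    (hi' : IsAdInvariantOn (analyticSubgroup (lieAddBracket m)) (lieAddBracket m) Q')
    (hhm : ∀ x y : lieAddBracket m, (x : GroupLieAlgebra 𝓘(ℝ, E) G) ∈ isotropyAlgebra E G o →
      (y : GroupLieAlgebra 𝓘(ℝ, E) G) ∈ m → Q x y = Q' x y)
    (hmm : ∀ x y : lieAddBracket m, (x : GroupLieAlgebra 𝓘(ℝ, E) G) ∈ m →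
      (y : GroupLieAlgebra 𝓘(ℝ, E) G) ∈ m → Q x y = Q' x y) : Q = Q' := by
  ext u v
  rw [← sub_eq_zero]
  refine form_eq_zero (D := fun u v ↦ Q u v - Q' u v) hm.isCompl.sup_eq_top ?_ ?_ ?_ ?_ ?_ ?_ ?_ ?_
    u v
  · intro u u' v; simp only [map_add, LinearMap.add_apply]; ring
  · intro u v v'; simp only [map_add]; ring
  · intro c u v; simp only [map_smul, LinearMap.smul_apply, smul_eq_mul]; ring
  · intro u v; rw [hs.eq u v, hs'.eq u v]
  · intro x hx v w hv hw
    have h₁ := hi.skew (Submodule.mem_sup_left hx) v w hv hw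
    have h₂ := hi'.skew (Submodule.mem_sup_left hx) v w hv hw
    linear_combination h₁ - h₂
  · exact fun x _ v hv ↦ lie_mem_addBracket hM hm x hv
  · exact fun u v hu hv ↦ sub_eq_zero.2 (hhm u v hu hv)
  · exact fun u v hu hv ↦ sub_eq_zero.2 (hmm u v hu hv)

end NaturallyReductiveSpaces

/-! ### Metrics from invariant forms -/

section InvariantForms

variable {E : Type*} [NormedAddCommGroup E] [NormedSpace ℝ E] [FiniteDimensional ℝ E]
  {E' : Type*} [NormedAddCommGroup E'] [NormedSpace ℝ E'] [FiniteDimensional ℝ E']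
  {G : Type*} [TopologicalSpace G] [ChartedSpace E G] [Group G] [LieGroup 𝓘(ℝ, E) ∞ G]
  {M : Type*} [TopologicalSpace M] [ChartedSpace E' M] [MulAction G M]
  {o : M} {Q : LinearMap.BilinForm ℝ (GroupLieAlgebra 𝓘(ℝ, E) G)}

omit [FiniteDimensional ℝ E] [TopologicalSpace M] in
/-- The complement `m = h^⊥` is reductive. -/
theorem isReductiveDecomposition_orthogonal [FiniteDimensional ℝ (GroupLieAlgebra 𝓘(ℝ, E) G)]
    (hs : Q.IsSymm) (hQ : ∀ (a : G) x y, Q (Ad a x) (Ad a y) = Q x y)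
    (hh : (Q.restrict (isotropyAlgebra E G o)).Nondegenerate) :
    IsReductiveDecomposition o (Q.orthogonal (isotropyAlgebra E G o)) where
  isCompl := (LinearMap.BilinForm.isCompl_orthogonal_of_restrict_nondegenerate hs.isRefl hh).symm
  ad_mem a ha x hx := by
    intro n hn
    have h₁ := hx _ (Ad_mem_lieAlgebraOf (inv_mem ha) hn)
    have h₂ := hQ a (Ad a⁻¹ n) x
    rw [Ad_Ad_inv] at h₂
    exact h₂.trans h₁

omit [FiniteDimensional ℝ E] [LieGroup 𝓘(ℝ, E) ∞ G] in
/-- If `g = h ⊕ h^⊥`, an element of `h^⊥` that is orthogonal to `h^⊥` vanishes. -/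
theorem eq_zero_of_mem_orthogonal (hnd : Q.Nondegenerate)
    {h : Submodule ℝ (GroupLieAlgebra 𝓘(ℝ, E) G)} (hc : IsCompl (Q.orthogonal h) h)
    {x : GroupLieAlgebra 𝓘(ℝ, E) G} (hx : x ∈ Q.orthogonal h)
    (h0 : ∀ y ∈ Q.orthogonal h, Q y x = 0) : x = 0 := by
  refine hnd.2 x fun z ↦ ?_
  obtain ⟨y, hy, n, hn, rfl⟩ := Submodule.mem_sup.1
    (hc.sup_eq_top ▸ Submodule.mem_top : z ∈ Q.orthogonal h ⊔ h)
  rw [map_add, LinearMap.add_apply, h0 y hy, zero_add]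
  exact hx n hn

theorem form_skew_of_Ad_invariant (hQ : ∀ (a : G) x y, Q (Ad a x) (Ad a y) = Q x y)
    (x y z : GroupLieAlgebra 𝓘(ℝ, E) G) : Q ⁅x, y⁆ z + Q y ⁅x, z⁆ = 0 := by
  have := FiniteDimensional.complete ℝ E
  obtain ⟨γ, hγ⟩ := exists_isOneParameterSubgroup x
  exact hγ.form_skew fun t ↦ hQ _ _ _

variable [IsManifold 𝓘(ℝ, E') ∞ M] [T2Space M]

/-- The orthogonal complement `k` of `m + [m, m]`, where `m = h^⊥`, is an ideal contained in `h`,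
so that it vanishes if the action is almost effective. -/
theorem addBracket_orthogonal_eq_top [ConnectedSpace M] (hM : IsHomogeneousSpace E E' G o)
    (hG : IsAlmostEffective G M)
    (hs : Q.IsSymm) (hnd : Q.Nondegenerate) (hQ : ∀ (a : G) x y, Q (Ad a x) (Ad a y) = Q x y)
    (hm : IsReductiveDecomposition o (Q.orthogonal (isotropyAlgebra E G o))) :
    addBracket (Q.orthogonal (isotropyAlgebra E G o)) = ⊤ := by
  have := FiniteDimensional.complete ℝ E
  have := hM.smooth
  have hfin : FiniteDimensional ℝ (GroupLieAlgebra 𝓘(ℝ, E) G) :=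
    inferInstanceAs (FiniteDimensional ℝ E)
  set m := Q.orthogonal (isotropyAlgebra E G o) with hmdef
  have hk : Q.orthogonal (addBracket m) ≤ isotropyAlgebra E G o := by
    intro x hx
    obtain ⟨y, hy, n, hn, rfl⟩ := Submodule.mem_sup.1
      (hm.isCompl.sup_eq_top ▸ Submodule.mem_top : x ∈ m ⊔ isotropyAlgebra E G o)
    have hy0 : y = 0 := by
      refine eq_zero_of_mem_orthogonal hnd hm.isCompl hy fun z hz ↦ ?_
      have h₁ : Q z (y + n) = 0 := hx z (Submodule.mem_sup_left hz)
      have h₂ : Q z n = 0 := (hs.eq z n).trans (hz n hn)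
      rwa [map_add, h₂, add_zero] at h₁
    rwa [hy0, zero_add]
  have hid : ∀ x ∈ (⊤ : Submodule ℝ (GroupLieAlgebra 𝓘(ℝ, E) G)), ∀ y ∈ Q.orthogonal (addBracket m),
      (⁅x, y⁆ : GroupLieAlgebra 𝓘(ℝ, E) G) ∈ Q.orthogonal (addBracket m) := by
    intro x _ y hy u hu
    have h₁ := form_skew_of_Ad_invariant hQ x u y
    have h₂ : Q ⁅x, u⁆ y = 0 := hy _ (lie_mem_addBracket hM hm x hu)
    rwa [h₂, zero_add] at h₁
  have h₁ : Q.orthogonal (addBracket m) = ⊥ := (Submodule.eq_bot_iff _).2 fun x hx ↦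
    eq_zero_of_isAlmostEffective (E' := E') hG (isPretransitive_analyticSubgroup_top hM) hk hid hx
  rw [← Q.orthogonal_orthogonal hnd hs.isRefl (addBracket m), h₁]
  exact Q.orthogonal_bot

omit [FiniteDimensional ℝ E'] [T2Space M] in
/-- A metric that is given by an invariant form `Q` on `m = h^⊥` is naturally reductive. -/
theorem isNaturallyReductiveDecomposition_of_form
    (hs : Q.IsSymm) (hQ : ∀ (a : G) x y, Q (Ad a x) (Ad a y) = Q x y)
    (hm : IsReductiveDecomposition o (Q.orthogonal (isotropyAlgebra E G o)))
    {met : PseudoRiemannianMetric E' M}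
    (hmet : ∀ x ∈ Q.orthogonal (isotropyAlgebra E G o), ∀ y ∈ Q.orthogonal (isotropyAlgebra E G o),
      metricAt E G met o x y = Q x y) :
    IsNaturallyReductiveDecomposition met o (Q.orthogonal (isotropyAlgebra E G o)) where
  toIsReductiveDecomposition := hm
  skew x hx y hy z hz := by
    have hp (u : GroupLieAlgebra 𝓘(ℝ, E) G) {w : GroupLieAlgebra 𝓘(ℝ, E) G}
        (hw : w ∈ Q.orthogonal (isotropyAlgebra E G o)) :
        Q ((Q.orthogonal (isotropyAlgebra E G o)).projection _ hm.isCompl u) w = Q u w := by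
      have h₁ : Q (u - _) w = 0 := hw _ (Submodule.sub_projection_mem hm.isCompl u)
      rw [map_sub, LinearMap.sub_apply, sub_eq_zero] at h₁
      exact h₁.symm
    have hp' (u : GroupLieAlgebra 𝓘(ℝ, E) G) {w : GroupLieAlgebra 𝓘(ℝ, E) G}
        (hw : w ∈ Q.orthogonal (isotropyAlgebra E G o)) :
        Q w ((Q.orthogonal (isotropyAlgebra E G o)).projection _ hm.isCompl u) = Q w u :=
      (hs.eq _ _).trans ((hp u hw).trans (hs.eq _ _))
    rw [hmet _ (Submodule.projection_apply_mem _ _) z hz,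
      hmet y hy _ (Submodule.projection_apply_mem _ _), hp _ hz, hp' _ hy]
    exact form_skew_of_Ad_invariant hQ x y z

/-- An invariant form `Q` induces an invariant metric. -/
theorem exists_metric_of_form (hM : IsHomogeneousSpace E E' G o)
    (hs : Q.IsSymm) (hnd : Q.Nondegenerate) (hQ : ∀ (a : G) x y, Q (Ad a x) (Ad a y) = Q x y)
    (hm : IsReductiveDecomposition o (Q.orthogonal (isotropyAlgebra E G o))) :
    ∃ met : PseudoRiemannianMetric E' M, met.IsInvariant G ∧
      ∀ x ∈ Q.orthogonal (isotropyAlgebra E G o), ∀ y ∈ Q.orthogonal (isotropyAlgebra E G o),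
        metricAt E G met o x y = Q x y := by
  have := FiniteDimensional.complete ℝ E
  have := FiniteDimensional.complete ℝ E'
  have := hM.smooth
  set m := Q.orthogonal (isotropyAlgebra E G o) with hmdef
  obtain ⟨s, hs₁, hs₂⟩ : ∃ s : E' →ₗ[ℝ] GroupLieAlgebra 𝓘(ℝ, E) G,
      (∀ v, (orbitDeriv (E' := E') E G o (s v) : E') = v) ∧ ∀ v, s v ∈ m := by
    let f : m →ₗ[ℝ] E' := (orbitDeriv (E' := E') E G o).toLinearMap ∘ₗ m.subtype
    have hf : LinearMap.range f = ⊤ := by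
      refine LinearMap.range_eq_top.2 fun v ↦ ?_
      obtain ⟨x, hx, hv⟩ := exists_mem_orbitDeriv_eq hM hm.isCompl v
      exact ⟨⟨x, hx⟩, hv⟩
    obtain ⟨g, hg⟩ := f.exists_rightInverse_of_surjective hf
    exact ⟨m.subtype ∘ₗ g, fun v ↦ LinearMap.congr_fun hg v, fun v ↦ (g v).2⟩
  have hs₃ {x : GroupLieAlgebra 𝓘(ℝ, E) G} (hx : x ∈ m) :
      s (orbitDeriv (E' := E') E G o x : E') = x := by
    have h₁ : s (orbitDeriv (E' := E') E G o x : E') - x ∈ m := sub_mem (hs₂ _) hx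
    refine sub_eq_zero.1 (Submodule.disjoint_def.1 hm.isCompl.disjoint _ h₁ ?_)
    refine (mem_isotropyAlgebra_iff (E' := E')).2 ?_
    refine (map_sub (orbitDeriv (E' := E') E G o) _ _).trans ?_
    exact sub_eq_zero.2 (hs₁ _)
  let B : E' →L[ℝ] E' →L[ℝ] ℝ := (Q.compl₁₂ s s).toContinuousBilinearMap
  have hB (v w : E') : B v w = Q (s v) (s w) := rfl
  have hQm {x y : GroupLieAlgebra 𝓘(ℝ, E) G} (hx : x ∈ m) (hy : y ∈ m) :
      B (orbitDeriv (E' := E') E G o x) (orbitDeriv (E' := E') E G o y) = Q x y := by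
    refine (hB _ _).trans ?_
    rw [hs₃ hx, hs₃ hy]
  have hBnd (v : E') (hv : ∀ w, B v w = 0) : v = 0 := by
    have h₁ : s v = 0 := by
      refine eq_zero_of_mem_orthogonal hnd hm.isCompl (hs₂ v) fun y hy ↦ ?_
      have h₂ := hv (orbitDeriv (E' := E') E G o y)
      have h₃ : Q (s v) y = 0 :=
        (congrArg (Q (s v)) (hs₃ hy)).symm.trans ((hB _ _).symm.trans h₂)
      exact (hs.eq _ _).trans h₃
    have h₂ := hs₁ v
    rw [h₁] at h₂
    exact h₂.symm.trans (map_zero (orbitDeriv (E' := E') E G o))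
  have hBinv : ∀ a ∈ MulAction.stabilizer G o, ∀ v w : E',
      B ((mfderiv 𝓘(ℝ, E') 𝓘(ℝ, E') (fun q : M ↦ a • q) o : E' →L[ℝ] E') v)
        ((mfderiv 𝓘(ℝ, E') 𝓘(ℝ, E') (fun q : M ↦ a • q) o : E' →L[ℝ] E') w) = B v w := by
    intro a ha v w
    have h₁ (v : E') : (mfderiv 𝓘(ℝ, E') 𝓘(ℝ, E') (fun q : M ↦ a • q) o : E' →L[ℝ] E') v =
        (orbitDeriv (E' := E') E G o (Ad a (s v)) : E') := by
      refine Eq.trans ?_ (orbitDeriv_Ad (E' := E') ha (s v)).symm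
      exact congrArg _ (hs₁ v).symm
    rw [h₁, h₁]
    refine (hQm (hm.ad_mem a ha _ (hs₂ v)) (hm.ad_mem a ha _ (hs₂ w))).trans ?_
    exact hQ a _ _
  obtain ⟨met, hinv, hmet⟩ := exists_isInvariant hM B (fun v w ↦ hs.eq _ _) hBnd hBinv
  exact ⟨met, hinv, fun x hx y hy ↦ (hmet _ _).trans (hQm hx hy)⟩

omit [FiniteDimensional ℝ E] [FiniteDimensional ℝ E'] [T2Space M] in
/-- An invariant metric is determined by its restriction to a complement of `h`. -/
theorem metric_unique (hM : IsHomogeneousSpace E E' G o)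
    {m : Submodule ℝ (GroupLieAlgebra 𝓘(ℝ, E) G)} (hc : IsCompl m (isotropyAlgebra E G o))
    {met met' : PseudoRiemannianMetric E' M} (h : met.IsInvariant G) (h' : met'.IsInvariant G)
    (he : ∀ x ∈ m, ∀ y ∈ m, metricAt E G met o x y = metricAt E G met' o x y) : met = met' := by
  have := hM.smooth
  refine h.eq_of_inner_eq (E := E) h' hM.transitive (o := o) fun v w ↦ ?_
  obtain ⟨x, hx, rfl⟩ := exists_mem_orbitDeriv_eq hM hc v
  obtain ⟨y, hy, rfl⟩ := exists_mem_orbitDeriv_eq hM hc w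
  exact he x hx y hy

end InvariantForms

end NaturallyReductive

end

open NaturallyReductive in
theorem theorem2p2
    {E : Type*} [NormedAddCommGroup E] [NormedSpace ℝ E] [FiniteDimensional ℝ E]
    {E' : Type*} [NormedAddCommGroup E'] [NormedSpace ℝ E'] [FiniteDimensional ℝ E']
    {G : Type*} [TopologicalSpace G] [ChartedSpace E G] [Group G] [LieGroup 𝓘(ℝ, E) ∞ G]
    {M : Type*} [TopologicalSpace M] [T2Space M] [ConnectedSpace M] [ChartedSpace E' M]
    [IsManifold 𝓘(ℝ, E') ∞ M] [MulAction G M]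
    (o : M) (hM : IsHomogeneousSpace E E' G o) (hG : IsAlmostEffective G M) :
    (∀ (met : PseudoRiemannianMetric E' M) (m : Submodule ℝ (GroupLieAlgebra 𝓘(ℝ, E) G)),
      met.IsInvariant G → IsNaturallyReductiveDecomposition met o m →
        (∀ x : GroupLieAlgebra 𝓘(ℝ, E) G, ∀ y ∈ addBracket m, ⁅x, y⁆ ∈ addBracket m) ∧
        MulAction.IsPretransitive (analyticSubgroup (addBracket m)) M ∧
        lieAlgebraOf (MulAction.stabilizer G o ⊓ analyticSubgroup (addBracket m)) ⊓ addBracket m =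
          isotropyAlgebra E G o ⊓ addBracket m ∧
        ∃! Q : LinearMap.BilinForm ℝ (addBracket m),
          Q.IsSymm ∧ Q.Nondegenerate ∧
          IsAdInvariantOn (analyticSubgroup (addBracket m)) (addBracket m) Q ∧
          (∀ x y : addBracket m, (x : GroupLieAlgebra 𝓘(ℝ, E) G) ∈ isotropyAlgebra E G o →
            (y : GroupLieAlgebra 𝓘(ℝ, E) G) ∈ m → Q x y = 0) ∧
          (∀ x y : addBracket m, (x : GroupLieAlgebra 𝓘(ℝ, E) G) ∈ m →
            (y : GroupLieAlgebra 𝓘(ℝ, E) G) ∈ m → Q x y = metricAt E G met o x y)) ∧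
    (ConnectedSpace G →
      ∀ (Q : LinearMap.BilinForm ℝ (GroupLieAlgebra 𝓘(ℝ, E) G))
        (m : Submodule ℝ (GroupLieAlgebra 𝓘(ℝ, E) G)),
        Q.IsSymm → Q.Nondegenerate → (∀ (a : G) x y, Q (Ad a x) (Ad a y) = Q x y) →
        (Q.restrict (isotropyAlgebra E G o)).Nondegenerate →
        m = Q.orthogonal (isotropyAlgebra E G o) →
          (∃! met : PseudoRiemannianMetric E' M, met.IsInvariant G ∧
            ∀ x ∈ m, ∀ y ∈ m, metricAt E G met o x y = Q x y) ∧
          (∀ met : PseudoRiemannianMetric E' M, met.IsInvariant G →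
            (∀ x ∈ m, ∀ y ∈ m, metricAt E G met o x y = Q x y) →
              IsNaturallyReductiveDecomposition met o m) ∧
          addBracket m = ⊤) := by
  have := hM.smooth
  refine ⟨fun met m hinv hm ↦ ?_, fun _ Q m hs hnd hQ hh hmQ ↦ ?_⟩
  · have hr := hm.toIsReductiveDecomposition
    refine ⟨fun x y ↦ lie_mem_addBracket hM hr x, isPretransitive_addBracket hM hr,
      lieAlgebraOf_stabilizer_inf_analyticSubgroup hM _, ?_⟩
    obtain ⟨Q, h₁, h₂, h₃, h₄, h₅⟩ := exists_form_addBracket hM hG hinv hm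
    refine ⟨Q, ⟨h₁, h₂, h₃, h₄, h₅⟩, ?_⟩
    rintro Q' ⟨h₁', -, h₃', h₄', h₅'⟩
    have := FiniteDimensional.complete ℝ E
    exact form_addBracket_unique hM hr h₁' h₁ h₃' h₃
      (fun x y hx hy ↦ (h₄' x y hx hy).trans (h₄ x y hx hy).symm)
      fun x y hx hy ↦ (h₅' x y hx hy).trans (h₅ x y hx hy).symm
  · subst hmQ
    have : FiniteDimensional ℝ (GroupLieAlgebra 𝓘(ℝ, E) G) :=
      inferInstanceAs (FiniteDimensional ℝ E)
    have hr := isReductiveDecomposition_orthogonal hs hQ hh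
    refine ⟨?_, fun met _ hmet ↦ isNaturallyReductiveDecomposition_of_form hs hQ hr hmet,
      addBracket_orthogonal_eq_top hM hG hs hnd hQ hr⟩
    obtain ⟨met, hinv, hmet⟩ := exists_metric_of_form hM hs hnd hQ hr
    refine ⟨met, ⟨hinv, hmet⟩, ?_⟩
    rintro met' ⟨hinv', hmet'⟩
    exact metric_unique hM hr.isCompl hinv' hinv
      fun x hx y hy ↦ (hmet' x hx y hy).trans (hmet x hx y hy).symm
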